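/- **Theorem 3.6 (modified Clark bases).** Let $\alpha,\beta$ be finite Blaschke products of degree $m>0$ and $n>0$ (a unimodular constant factor is allowed). Let $H^2\subset L^2(\partial\mathbb D)$ be the Hardy space and $K_\alpha=H^2\ominus\alpha H^2$, $K_\beta=H^2\ominus\beta H^2$ the model spaces. Let $\mathcal T(\alpha,\beta)$ be the set of bounded operators $A\colon K_\alpha\to K_\beta$ of the form $Af=P_\beta(\varphi f)$ with $\varphi\in L^2(\partial\mathbb D)$, where $P_\beta$ is the orthogonal projection of $L^2(\partial\mathbb D)$ onto $K_\beta$. For $\lambda_1,\lambda_2\in\partial\mathbb D$ put $$\alpha_{\lambda_1}=\frac{\lambda_1+\alpha(0)}{1+\overline{\alpha(0)}\lambda_1},\qquad \beta_{\lambda_2}=\frac{\lambda_2+\beta(0)}{1+\overline{\beta(0)}\lambda_2}.$$ Let $\eta_1,\dots,\eta_m\in\partial\mathbb D$ be the $m$ distinct solutions of $\alpha(\eta)=\alpha_{\lambda_1}$ and $\zeta_1,\dots,\zeta_n\in\partial\mathbb D$ the $n$ distinct solutions of $\beta(\zeta)=\beta_{\lambda_2}$. Assume that the sets $\{\eta_1,\dots,\eta_m\}$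 and $\{\zeta_1,\dots,\zeta_n\}$ have precisely $l\ge 0$ elements in common, namely $\eta_j=\zeta_j$ for $j\le l$. Let $\mu_1,\mu_2\in\partial\mathbb D$ be arbitrary, and put $$\omega_j^\alpha=e^{-\frac i2(\arg\eta_j-\arg\mu_1)},\quad e^\alpha_{\eta_j}=\omega_j^\alpha\,\|k^\alpha_{\eta_j}\|^{-1}k^\alpha_{\eta_j},\qquad \omega_j^\beta=e^{-\frac i2(\arg\zeta_j-\arg\mu_2)},\quad e^\beta_{\zeta_j}=\omega_j^\beta\,\|k^\beta_{\zeta_j}\|^{-1}k^\beta_{\zeta_j},$$ where $\arg$ is the principal argument, $k_\eta^\alpha(z)=\dfrac{1-\overline{\alpha(\eta)}\alpha(z)}{1-\overline{\eta}z}$ (similarly for $\beta$) and $\|\cdot\|$ is the norm of $L^2(\partial\mathbb D)$ for normalized arc length. Then $\{e^\alpha_{\eta_j}\}_{j\le m}$ and $\{e^\beta_{\zeta_j}\}_{j\le n}$ are orthonormal bases of $K_\alpha$ and $K_\beta$. If $\mu_1=\alpha_{\lambda_1}$, then each $e^\alpha_{\eta_j}$ is fixed by the conjugation $C_\alpha f(z)=\alpha(z)\overline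 z\,\overline{f(z)}$ ($|z|=1$); if $\mu_2=\beta_{\lambda_2}$, then each $e^\beta_{\zeta_j}$ is fixed by $C_\beta$. Moreover, for every linear map $A\colon K_\alpha\to K_\beta$ with matrix $(t_{s,p})_{1\le s\le n,\,1\le p\le m}$ in these bases, i.e. $Ae^\alpha_{\eta_p}=\sum_s t_{s,p}e^\beta_{\zeta_s}$, the following hold. (a) If $l=0$, then $A\in\mathcal T(\alpha,\beta)$ if and only if, for all $1\le p\le m$ and $1\le s\le n$, $$t_{s,p}=\frac{\sqrt{|\alpha'(\eta_1)|}}{\sqrt{|\alpha'(\eta_p)|}}\frac{\omega_1^\alpha}{\omega_p^\alpha}\frac{\eta_1-\zeta_s}{\eta_p-\zeta_s}t_{s,1}+\frac{\sqrt{|\alpha'(\eta_1)|}\sqrt{|\beta'(\zeta_1)|}}{\sqrt{|\alpha'(\eta_p)|}\sqrt{|\beta'(\zeta_s)|}}\frac{\omega_1^\alpha\omega_1^\beta}{\omega_p^\alpha\omega_s^\beta}\frac{\zeta_1-\eta_1}{\eta_p-\zeta_s}t_{1,1}+\frac{\sqrt{|\beta'(\zeta_1)|}}{\sqrt{|\beta'(\zeta_s)|}}\frac{\omega_1^\beta}{\omega_s^\beta}\frac{\eta_p-\zeta_1}{\eta_p-\zeta_s}t_{1,p}.$$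 (b) If $l>0$, then $A\in\mathcal T(\alpha,\beta)$ if and only if $$t_{s,p}=\frac{\sqrt{|\alpha'(\eta_s)|}\sqrt{|\beta'(\zeta_1)|}}{\sqrt{|\alpha'(\eta_p)|}\sqrt{|\beta'(\zeta_s)|}}\frac{\omega_s^\alpha\omega_1^\beta}{\omega_p^\alpha\omega_s^\beta}\frac{\eta_1-\zeta_s}{\eta_p-\zeta_s}t_{1,s}+\frac{\sqrt{|\beta'(\zeta_1)|}}{\sqrt{|\beta'(\zeta_s)|}}\frac{\omega_1^\beta}{\omega_s^\beta}\frac{\eta_p-\zeta_1}{\eta_p-\zeta_s}t_{1,p}$$ for all $1\le p\le m$, $1\le s\le l$ with $s\ne p$, and $$t_{s,p}=\frac{\sqrt{|\alpha'(\eta_1)|}}{\sqrt{|\alpha'(\eta_p)|}}\frac{\omega_1^\alpha}{\omega_p^\alpha}\frac{\eta_1-\zeta_s}{\eta_p-\zeta_s}t_{s,1}+\frac{\sqrt{|\beta'(\zeta_1)|}}{\sqrt{|\beta'(\zeta_s)|}}\frac{\omega_1^\beta}{\omega_s^\beta}\frac{\eta_p-\zeta_1}{\eta_p-\zeta_s}t_{1,p}$$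 for all $1\le p\le m$ and $l<s\le n$. (The case $\mu_1=\lambda_1$, $\mu_2=\lambda_2$ is the one where $\omega_j^\alpha=e^{-\frac i2(\arg\eta_j-\arg\lambda_1)}$ and $\omega_j^\beta=e^{-\frac i2(\arg\zeta_j-\arg\lambda_2)}$.) -/

import Mathlib

open MeasureTheory AddCircle
open scoped ComplexConjugate Real InnerProductSpace

noncomputable section

namespace ModelSpace

/-- The circle `ℝ / 2πℤ`, parametrizing the unit circle by `t ↦ e^{it}`. -/
abbrev T : Type := AddCircle (2 * π)

instance fact_two_pi_pos : Fact (0 < 2 * π) := ⟨Real.two_pi_pos⟩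

/-- The point `e^{it}` of the unit circle, as a complex number. -/
def pt (t : T) : ℂ := (AddCircle.toCircle t : ℂ)

/-- The space `L²(∂𝔻)` for normalized arc length. -/
abbrev L2 : Type := Lp ℂ 2 (haarAddCircle : Measure T)

/-- The Hardy space `H²`, as the space of boundary functions: the functions in `L²(∂𝔻)` all of
whose Fourier coefficients of negative index vanish. -/
def hardy : Submodule ℂ L2 where
  carrier := {f | ∀ n : ℤ, n < 0 → fourierCoeff (f : T → ℂ) n = 0}
  zero_mem' := by
    intro n _
    rw [← fourierBasis_repr, map_zero]; rfl
  add_mem' := by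
    intro f g hf hg n hn
    have hf' := hf n hn
    have hg' := hg n hn
    rw [← fourierBasis_repr] at hf' hg' ⊢
    rw [map_add]
    simp [hf', hg']
  smul_mem' := by
    intro c f hf n hn
    have hf' := hf n hn
    rw [← fourierBasis_repr] at hf' ⊢
    rw [map_smul]
    simp [hf']

/-- The space `αH²` of all products `αh` with `h ∈ H²` (`α` is a function on the plane that is
restricted to the unit circle). -/
def mulHardy (α : ℂ → ℂ) : Submodule ℂ L2 where
  carrier := {g | ∃ h ∈ hardy, (g : T → ℂ) =ᵐ[haarAddCircle] fun t => α (pt t) * h t}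
  zero_mem' := by
    refine ⟨0, hardy.zero_mem, ?_⟩
    filter_upwards [Lp.coeFn_zero ℂ 2 (haarAddCircle : Measure T)] with t ht
    rw [ht, Pi.zero_apply, mul_zero]
  add_mem' := by
    rintro f g ⟨u, hu, hfu⟩ ⟨v, hv, hgv⟩
    refine ⟨u + v, hardy.add_mem hu hv, ?_⟩
    filter_upwards [Lp.coeFn_add f g, Lp.coeFn_add u v, hfu, hgv] with t h1 h2 h3 h4
    rw [h1, h2, Pi.add_apply, Pi.add_apply, h3, h4, mul_add]
  smul_mem' := by
    rintro c f ⟨u, hu, hfu⟩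
    refine ⟨c • u, hardy.smul_mem c hu, ?_⟩
    filter_upwards [Lp.coeFn_smul c f, Lp.coeFn_smul c u, hfu] with t h1 h2 h3
    rw [h1, h2, Pi.smul_apply, Pi.smul_apply, h3, smul_eq_mul, smul_eq_mul, mul_left_comm]

/-- The model space `K_α = H² ⊖ αH²`. -/
def K (α : ℂ → ℂ) : Submodule ℂ L2 := hardy ⊓ (mulHardy α)ᗮ

theorem isClosed_hardy : IsClosed (hardy : Set L2) := by
  have h : (hardy : Set L2) = ⋂ n : ℤ, ⋂ _ : n < 0,
      {f : L2 | ⟪(fourierBasis n : L2), f⟫_ℂ = 0} := by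
    ext f
    simp only [Set.mem_iInter, Set.mem_ofPred_eq, SetLike.mem_coe]
    refine forall_congr' fun n => forall_congr' fun _ => ?_
    rw [← fourierBasis_repr, HilbertBasis.repr_apply_apply]
  rw [h]
  exact isClosed_iInter fun n => isClosed_iInter fun _ =>
    isClosed_eq (continuous_const.inner continuous_id) continuous_const

instance hasOrthogonalProjection_K (α : ℂ → ℂ) : (K α).HasOrthogonalProjection := by
  have h : IsClosed (K α : Set L2) :=
    isClosed_hardy.inter (Submodule.isClosed_orthogonal (mulHardy α))
  have : CompleteSpace (K α) := h.completeSpace_coe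
  infer_instance

/-- `α` is a finite Blaschke product of degree `m`: a unimodular constant times a product of `m`
Blaschke factors with zeros (not necessarily distinct) in the open unit disk. -/
def IsFiniteBlaschke (m : ℕ) (α : ℂ → ℂ) : Prop :=
  ∃ (c : Circle) (a : Fin m → ℂ), (∀ i, ‖a i‖ < 1) ∧
    ∀ z, α z = c * ∏ i, (a i - z) / (1 - conj (a i) * z)

/-- The class `𝒯(α, β)` of bounded asymmetric truncated Toeplitz operators: the operators
`f ↦ P_β(φ f)` from `K_α` to `K_β`, with symbol `φ ∈ L²(∂𝔻)`, where `P_β` is the orthogonal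
projection of `L²(∂𝔻)` onto `K_β`. (For finite Blaschke products `K_α` consists of bounded
functions, so that `φ f ∈ L²(∂𝔻)` for every `f ∈ K_α`.) -/
def toeplitzClass (α β : ℂ → ℂ) : Set (K α →ₗ[ℂ] K β) :=
  {A | Continuous A ∧ ∃ φ : L2, ∀ f : K α,
    ∃ h : MemLp (fun t => φ t * (f : L2) t) 2 (haarAddCircle : Measure T),
      A f = (K β).orthogonalProjectionOnto (h.toLp _)}

/-- The kernel function `k_w^α(z) = (1 - conj (α w) α z) / (1 - conj w z)`. -/
def kernel (α : ℂ → ℂ) (w z : ℂ) : ℂ := (1 - conj (α w) * α z) / (1 - conj w * z)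

/-- The `L²(∂𝔻)` norm of the kernel function `k_w^α`. -/
def kernelNorm (α : ℂ → ℂ) (w : ℂ) : ℝ :=
  (eLpNorm (fun t => kernel α w (pt t)) 2 (haarAddCircle : Measure T)).toReal

/-- The unimodular number `α_λ = (λ + α(0)) / (1 + conj (α(0)) λ)`. -/
def clarkValue (α : ℂ → ℂ) (lam : ℂ) : ℂ := (lam + α 0) / (1 + conj (α 0) * lam)

/-- The normalized kernel function `v_η^α = ‖k_η^α‖⁻¹ k_η^α` on the circle. -/
def clarkFun (α : ℂ → ℂ) (η : ℂ) (t : T) : ℂ :=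
  ((kernelNorm α η : ℝ) : ℂ)⁻¹ * kernel α η (pt t)

/-- The unimodular factor `ω = exp (-(i/2) (arg η - arg μ))`. -/
def phase (μ η : ℂ) : ℂ :=
  Complex.exp (-(Complex.I / 2) * ((Complex.arg η : ℂ) - (Complex.arg μ : ℂ)))

/-- The modified normalized kernel function `e_η^α = ω v_η^α` on the circle. -/
def modifiedClarkFun (α : ℂ → ℂ) (μ η : ℂ) (t : T) : ℂ := phase μ η * clarkFun α η t

/-- The conjugation `C_α f (z) = α(z) conj z conj (f z)` on functions on the unit circle. -/
def modelConj (α : ℂ → ℂ) (f : T → ℂ) (t : T) : ℂ := α (pt t) * conj (pt t) * conj (f t)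

/-- The number `√|α'(η)|`, as a complex number. -/
def rootDeriv (α : ℂ → ℂ) (η : ℂ) : ℂ := (Real.sqrt ‖deriv α η‖ : ℝ)

end ModelSpace

end

open ModelSpace

/-! ### The unit circle: null sets and mean values -/

namespace ModelSpace

/-! Write `α = c · num / den`. On the circle `num = (-z)^m · conj den`, so `K α` is exactly the
space of fractions `p / den` with `deg p < m`. Boundary kernels are such fractions, reproduce the
value at `ξ`, and satisfy `‖k_ξ‖² = |α'(ξ)|`. The `m` nodes form a level set of `α`, so the kernels
vanish at each other's nodes; hence the normalized ones are an orthonormal basis.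

An operator is in the class iff some symbol `φ` makes its entries the moments `∫ φ e_p conj(f_s)`.
With `a_p = ω_p √|α'(η_p)|`, the function `a_p (η_p - z) e_p` does not depend on `p`, and likewise
`b_s (ζ_s - z) conj(f_s)` does not depend on `s`. By partial fractions `a_p b_s (η_p - ζ_s) e_p
conj(f_s)` is a term in `s` minus a term in `p`, so its alternating sum over any two rows and two
columns is zero. Integrated against `φ`, this four-term relation gives the stated formulas. When the
nodes coincide at `j ≤ l`, the weight `η_s - ζ_s` is zero and diagonal entries drop out.

Conversely, the formulas determine the matrix from its first row, the entries of its first column in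
rows beyond `l`, and the diagonal entries up to `l`. The products `e_p conj(f_s)` at these positions
are linearly independent, so an invertible Gram matrix yields a symbol with these entries. Its
operator obeys the same relations, and so agrees with `A` everywhere. -/

theorem norm_pt (t : T) : ‖pt t‖ = 1 := Circle.norm_coe _

theorem pt_ne_zero (t : T) : pt t ≠ 0 := Circle.coe_ne_zero _

theorem continuous_pt : Continuous pt :=
  continuous_subtype_val.comp AddCircle.continuous_toCircle

theorem pt_mul_conj (t : T) : pt t * conj (pt t) = 1 := by
  rw [Complex.mul_conj, Complex.normSq_eq_norm_sq, norm_pt]; norm_num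

theorem circle_mul_conj (ξ : Circle) : (ξ : ℂ) * conj (ξ : ℂ) = 1 := by
  rw [Complex.mul_conj, Complex.normSq_eq_norm_sq, Circle.norm_coe]; norm_num

theorem pt_injective : Function.Injective pt :=
  Subtype.val_injective.comp (AddCircle.injective_toCircle Real.two_pi_pos.ne')

theorem exists_pt_eq (ξ : Circle) : ∃ t, pt t = ξ :=
  ⟨(Complex.arg ξ : ℝ), by
    unfold pt
    rw [AddCircle.toCircle_apply_mk, div_self Real.two_pi_pos.ne', one_mul, Circle.exp_arg]⟩

theorem fourier_eq_pt_zpow (n : ℤ) (t : T) : fourier n t = pt t ^ n := by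
  rw [fourier_apply, AddCircle.toCircle_zsmul, Circle.coe_zpow]; rfl

instance haarAddCircle_nullSingletonClass : NullSingletonClass (haarAddCircle : Measure T) := by
  refine ⟨fun x => ?_⟩
  have h : (volume : Measure T) {x} = 0 := by
    have := AddCircle.volume_closedBall (2 * π) (x := x) 0
    rw [Metric.closedBall_zero] at this
    rw [this, mul_zero, min_eq_right Real.two_pi_pos.le, ENNReal.ofReal_zero]
  rw [volume_eq_smul_haarAddCircle, Measure.smul_apply, smul_eq_mul, mul_eq_zero] at h
  exact h.resolve_left (by simpa using Real.two_pi_pos)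

theorem ae_pt_notMem {S : Set ℂ} (hS : S.Finite) : ∀ᵐ t ∂(haarAddCircle : Measure T), pt t ∉ S := by
  have h : (pt ⁻¹' S).Finite := hS.preimage pt_injective.injOn
  exact measure_eq_zero_iff_ae_notMem.1 (h.measure_zero haarAddCircle)

/-- The mean value property for analytic functions. It evaluates the integrals of all fractions `p /
den` below; the zeroth Fourier coefficient links Haar measure to the circle average. -/
theorem integral_pt {F : ℂ → ℂ} (hF : DiffContOnCl ℂ F (Metric.ball 0 1)) :
    ∫ t, F (pt t) ∂(haarAddCircle : Measure T) = F 0 := by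
  have h1 := fourierCoeff_eq_intervalIntegral (T := 2 * π) (fun t => F (pt t)) 0 0
  have h2 : Real.circleAverage F 0 1 = F 0 :=
    DiffContOnCl.circleAverage (by simpa using hF)
  rw [← h2, Real.circleAverage_def]
  have h3 : fourierCoeff (fun t : T => F (pt t)) 0 = ∫ t, F (pt t) ∂(haarAddCircle : Measure T) := by
    simp [fourierCoeff]
  rw [← h3, h1, zero_add, one_div]
  congr 1
  refine intervalIntegral.integral_congr fun θ _ => ?_
  simp only [neg_zero, fourier_zero, one_smul]
  congr 1
  unfold pt
  rw [AddCircle.toCircle_apply_mk, div_self Real.two_pi_pos.ne', one_mul, Circle.coe_exp]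
  simp [circleMap]

theorem eq_zero_of_ae_eq_zero {g : T → ℂ} (hg : Continuous g)
    (h : g =ᵐ[haarAddCircle] 0) : g = 0 :=
  (hg.ae_eq_iff_eq _ continuous_const).1 h

/-- The class in `L²(∂𝔻)` of a continuous function. -/
noncomputable def toL2 (g : C(T, ℂ)) : L2 :=
  ContinuousMap.toLp 2 (haarAddCircle : Measure T) ℂ g

theorem coeFn_toL2 (g : C(T, ℂ)) : (toL2 g : T → ℂ) =ᵐ[haarAddCircle] g :=
  ContinuousMap.coeFn_toLp _ _

theorem inner_eq_integral (f g : L2) :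
    ⟪f, g⟫_ℂ = ∫ t, g t * conj (f t) ∂(haarAddCircle : Measure T) := by
  rw [MeasureTheory.L2.inner_def]; rfl

/-! ### Symbols with prescribed moments -/

open scoped ComplexOrder in
-- The Gram matrix of an independent family is positive definite, hence invertible, so a solution
-- exists already in the span of the family.
theorem exists_inner_eq_of_linearIndependent {ι H : Type*} [Fintype ι] [DecidableEq ι]
    [NormedAddCommGroup H] [InnerProductSpace ℂ H] {v : ι → H} (hv : LinearIndependent ℂ v)
    (c : ι → ℂ) : ∃ w : H, ∀ i, ⟪v i, w⟫_ℂ = c i := by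
  have hu : IsUnit (Matrix.gram ℂ v) := (Matrix.posDef_gram_of_linearIndependent hv).isUnit
  obtain ⟨x, hx⟩ := Matrix.mulVec_surjective_iff_isUnit.2 hu c
  refine ⟨∑ j, x j • v j, fun i => ?_⟩
  rw [← hx, inner_sum]
  simp [Matrix.mulVec, dotProduct, Matrix.gram_apply, inner_smul_right, mul_comm]

theorem exists_integral_mul_eq {ι : Type*} [Fintype ι] [DecidableEq ι] (g : ι → C(T, ℂ))
    (hg : ∀ d : ι → ℂ, (∀ t, ∑ i, d i * g i t = 0) → ∀ i, d i = 0) (c : ι → ℂ) :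
    ∃ φ : L2, ∀ i, ∫ t, φ t * g i t ∂(haarAddCircle : Measure T) = c i := by
  -- The moment `∫ φ g` is the inner product with `conj g`, so independence is needed for the
  -- conjugates; the coefficients are conjugated to return to `hg`.
  have hv : LinearIndependent ℂ fun i => toL2 (star (g i)) := by
    rw [Fintype.linearIndependent_iff]
    intro d hd
    have h1 : toL2 (∑ i, d i • star (g i)) = 0 := by
      rw [← hd]; simp only [toL2, map_sum, map_smul]
    have h2 : (∑ i, d i • star (g i) : C(T, ℂ)) = 0 :=
      ContinuousMap.toLp_injective (haarAddCircle : Measure T) (𝕜 := ℂ) (p := 2)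
        (by rw [map_zero]; exact h1)
    have h3 : ∀ i, conj (d i) = 0 := by
      refine hg (fun i => conj (d i)) fun t => ?_
      have := congrArg (fun u : C(T, ℂ) => conj (u t)) h2
      simpa [ContinuousMap.sum_apply, map_sum] using this
    intro i
    simpa using h3 i
  obtain ⟨φ, hφ⟩ := exists_inner_eq_of_linearIndependent hv c
  refine ⟨φ, fun i => ?_⟩
  rw [← hφ i, inner_eq_integral]
  refine integral_congr_ae ?_
  filter_upwards [coeFn_toL2 (star (g i))] with t ht
  rw [ht]; simp

open Polynomial

/-! ### Fractions `p / den` on the circle belong to the model space -/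

section Blaschke

variable {m : ℕ}

/-- The denominator `∏ (1 - conj (aᵢ) X)` of a finite Blaschke product. -/
noncomputable def blaschkeDen (a : Fin m → ℂ) : ℂ[X] := ∏ i, (1 - C (conj (a i)) * X)

/-- The numerator `∏ (aᵢ - X)` of a finite Blaschke product. -/
noncomputable def blaschkeNum (a : Fin m → ℂ) : ℂ[X] := ∏ i, (C (a i) - X)

theorem eval_blaschkeDen (a : Fin m → ℂ) (z : ℂ) :
    (blaschkeDen a).eval z = ∏ i, (1 - conj (a i) * z) := by
  simp [blaschkeDen, eval_prod]

theorem eval_blaschkeNum (a : Fin m → ℂ) (z : ℂ) :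
    (blaschkeNum a).eval z = ∏ i, (a i - z) := by
  simp [blaschkeNum, eval_prod]

theorem natDegree_blaschkeDen_le (a : Fin m → ℂ) : (blaschkeDen a).natDegree ≤ m := by
  refine (natDegree_prod_le _ _).trans ((Finset.sum_le_card_nsmul _ _ 1 fun i _ => ?_).trans ?_)
  · compute_degree
  · simp

theorem natDegree_blaschkeNum_le (a : Fin m → ℂ) : (blaschkeNum a).natDegree ≤ m := by
  refine (natDegree_prod_le _ _).trans ((Finset.sum_le_card_nsmul _ _ 1 fun i _ => ?_).trans ?_)
  · compute_degree
  · simp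

theorem eval_blaschkeDen_zero (a : Fin m → ℂ) : (blaschkeDen a).eval 0 = 1 := by
  simp [eval_blaschkeDen]

theorem eval_blaschkeDen_ne_zero {a : Fin m → ℂ} (ha : ∀ i, ‖a i‖ < 1) {z : ℂ} (hz : ‖z‖ ≤ 1) :
    (blaschkeDen a).eval z ≠ 0 := by
  rw [eval_blaschkeDen, Finset.prod_ne_zero_iff]
  intro i _ h
  have h1 : ‖conj (a i) * z‖ = 1 := by rw [← sub_eq_zero.1 h, norm_one]
  rw [norm_mul, RCLike.norm_conj] at h1
  nlinarith [ha i, norm_nonneg (a i), norm_nonneg z]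

/-- Factor by factor, `a - z = -z · conj (1 - conj a · z)` when `|z| = 1`. -/
theorem eval_blaschkeNum_pt (a : Fin m → ℂ) (t : T) :
    (blaschkeNum a).eval (pt t) = (-pt t) ^ m * conj ((blaschkeDen a).eval (pt t)) := by
  rw [eval_blaschkeNum, eval_blaschkeDen, map_prod, ← Fin.prod_const, ← Finset.prod_mul_distrib]
  refine Finset.prod_congr rfl fun i _ => ?_
  have := pt_mul_conj t
  simp only [map_sub, map_one, map_mul, Complex.conj_conj]
  linear_combination (- a i) * this

theorem den_pt_ne_zero {a : Fin m → ℂ} (ha : ∀ i, ‖a i‖ < 1) (t : T) :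
    (blaschkeDen a).eval (pt t) ≠ 0 := eval_blaschkeDen_ne_zero ha (norm_pt t).le

/-- The restriction of the rational function `p / ∏ (1 - conj (aᵢ) X)` to the circle. -/
noncomputable def ratFun {a : Fin m → ℂ} (ha : ∀ i, ‖a i‖ < 1) (p : ℂ[X]) : C(T, ℂ) where
  toFun t := p.eval (pt t) / (blaschkeDen a).eval (pt t)
  continuous_toFun := (p.continuous.comp continuous_pt).div
    ((blaschkeDen a).continuous.comp continuous_pt) (den_pt_ne_zero ha)

theorem ratFun_apply {a : Fin m → ℂ} (ha : ∀ i, ‖a i‖ < 1) (p : ℂ[X]) (t : T) :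
    ratFun ha p t = p.eval (pt t) / (blaschkeDen a).eval (pt t) := rfl

theorem integrable_of_continuous {g : T → ℂ} (hg : Continuous g) :
    Integrable g (haarAddCircle : Measure T) :=
  (ContinuousMap.mk g hg).toLp 1 haarAddCircle ℂ |> L1.integrable_coeFn |>.congr
    (ContinuousMap.coeFn_toLp _ _)

theorem integral_ratFun {a : Fin m → ℂ} (ha : ∀ i, ‖a i‖ < 1) (p : ℂ[X]) :
    ∫ t, ratFun ha p t ∂(haarAddCircle : Measure T) = p.eval 0 := by
  have h := integral_pt (F := fun z => p.eval z / (blaschkeDen a).eval z) (by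
    refine DifferentiableOn.diffContOnCl fun z hz => ?_
    rw [closure_ball _ one_ne_zero, mem_closedBall_zero_iff] at hz
    exact (p.differentiable.differentiableAt.div (blaschkeDen a).differentiable.differentiableAt
      (eval_blaschkeDen_ne_zero ha hz)).differentiableWithinAt)
  rw [eval_blaschkeDen_zero, div_one] at h
  exact h

theorem fourierCoeff_ratFun_eq_zero {a : Fin m → ℂ} (ha : ∀ i, ‖a i‖ < 1) (p : ℂ[X]) {n : ℤ}
    (hn : n < 0) : fourierCoeff (ratFun ha p) n = 0 := by
  obtain ⟨k, rfl⟩ := Int.exists_eq_neg_ofNat hn.le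
  have h := integral_ratFun ha (X ^ k * p)
  have hk : k ≠ 0 := by rintro rfl; simp at hn
  rw [eval_mul, eval_pow, eval_X, zero_pow hk, zero_mul] at h
  rw [← h]
  refine integral_congr_ae (.of_forall fun t => ?_)
  simp only [neg_neg, smul_eq_mul]
  rw [fourier_eq_pt_zpow, zpow_natCast, ratFun_apply, ratFun_apply, eval_mul, eval_pow, eval_X,
    mul_div_assoc]

/-- The `m`-th reflection of a polynomial of degree `< m` on the circle. -/
theorem exists_reflect {p : ℂ[X]} (hp : p.degree < m) :
    ∃ p' : ℂ[X], ∀ t, pt t ^ m * conj (p.eval (pt t)) = pt t * p'.eval (pt t) := by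
  refine ⟨∑ k ∈ Finset.range m, C (conj (p.coeff k)) * X ^ (m - 1 - k), fun t => ?_⟩
  have h : p.natDegree < m ∨ p = 0 := by
    by_cases h : p = 0
    · exact .inr h
    · exact .inl ((natDegree_lt_iff_degree_lt h).2 hp)
  rcases h with h | rfl
  · rw [eval_eq_sum_range' h, map_sum, Finset.mul_sum, eval_finsetSum, Finset.mul_sum]
    refine Finset.sum_congr rfl fun k hk => ?_
    have hk' := Finset.mem_range.1 hk
    have h1 : (pt t) ^ k * conj (pt t) ^ k = 1 := by rw [← mul_pow, pt_mul_conj, one_pow]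
    have h2 : (pt t) ^ m = pt t * pt t ^ (m - 1 - k) * pt t ^ k := by
      rw [← pow_succ', ← pow_add]; congr 1; omega
    simp only [map_mul, map_pow, eval_mul, eval_C, eval_pow, eval_X]
    rw [h2]
    linear_combination (pt t * pt t ^ (m - 1 - k) * conj (p.coeff k)) * h1
  · simp

variable {α : ℂ → ℂ} {c : Circle} {a : Fin m → ℂ}

theorem conj_den_ne_zero (ha : ∀ i, ‖a i‖ < 1) (t : T) :
    conj ((blaschkeDen a).eval (pt t)) ≠ 0 := by
  rw [Ne, map_eq_zero]; exact den_pt_ne_zero ha t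

theorem blaschke_mul_den (hα : ∀ z, α z = c * ((blaschkeNum a).eval z / (blaschkeDen a).eval z))
    {z : ℂ} (hz : (blaschkeDen a).eval z ≠ 0) :
    α z * (blaschkeDen a).eval z = c * (blaschkeNum a).eval z := by
  rw [hα, mul_assoc, div_mul_cancel₀ _ hz]

theorem blaschke_mul_conj (ha : ∀ i, ‖a i‖ < 1)
    (hα : ∀ z, α z = c * ((blaschkeNum a).eval z / (blaschkeDen a).eval z)) (t : T) :
    α (pt t) * conj (α (pt t)) = 1 := by
  have h1 := den_pt_ne_zero ha t
  have h2 := conj_den_ne_zero ha t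
  have h3 : (-pt t) ^ m * conj (-pt t) ^ m = 1 := by
    rw [← mul_pow, map_neg, neg_mul_neg, pt_mul_conj, one_pow]
  rw [hα, eval_blaschkeNum_pt]
  simp only [map_mul, map_div₀, map_pow, Complex.conj_conj]
  field_simp
  linear_combination (conj (-pt t) ^ m * (-pt t) ^ m ) * circle_mul_conj c + h3

theorem continuous_blaschke_pt (ha : ∀ i, ‖a i‖ < 1)
    (hα : ∀ z, α z = c * ((blaschkeNum a).eval z / (blaschkeDen a).eval z)) :
    Continuous fun t => α (pt t) := by
  simp only [hα]
  exact continuous_const.mul (ratFun ha (blaschkeNum a)).continuous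

/-- On the circle, `α · conj (p / q)` extends to an analytic function that vanishes at `0`. -/
theorem exists_blaschke_mul_conj_ratFun (ha : ∀ i, ‖a i‖ < 1)
    (hα : ∀ z, α z = c * ((blaschkeNum a).eval z / (blaschkeDen a).eval z))
    {p : ℂ[X]} (hp : p.degree < m) :
    ∃ p' : ℂ[X], ∀ t, α (pt t) * conj (ratFun ha p t) = ratFun ha (X * p') t := by
  obtain ⟨p', hp'⟩ := exists_reflect hp
  refine ⟨C ((c : ℂ) * (-1) ^ m) * p', fun t => ?_⟩
  have h1 := den_pt_ne_zero ha t
  have h2 := conj_den_ne_zero ha t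
  rw [hα, eval_blaschkeNum_pt, ratFun_apply, ratFun_apply, neg_pow, map_div₀]
  simp only [eval_mul, eval_X, eval_C]
  field_simp
  linear_combination hp' t

theorem integral_ratFun_mul_conj_blaschke (ha : ∀ i, ‖a i‖ < 1)
    (hα : ∀ z, α z = c * ((blaschkeNum a).eval z / (blaschkeDen a).eval z))
    {p : ℂ[X]} (hp : p.degree < m) :
    ∫ t, ratFun ha p t * conj (α (pt t)) ∂(haarAddCircle : Measure T) = 0 := by
  obtain ⟨p', hp'⟩ := exists_blaschke_mul_conj_ratFun ha hα hp
  have h : ∫ t, conj (ratFun ha p t * conj (α (pt t))) ∂(haarAddCircle : Measure T) = 0 := by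
    simp_rw [map_mul, Complex.conj_conj, mul_comm (conj _), hp']
    rw [integral_ratFun]; simp
  rwa [integral_conj, map_eq_zero] at h

theorem toL2_ratFun_mem_hardy (ha : ∀ i, ‖a i‖ < 1) (p : ℂ[X]) : toL2 (ratFun ha p) ∈ hardy := by
  intro n hn
  rw [fourierCoeff_congr_ae (coeFn_toL2 _), fourierCoeff_ratFun_eq_zero ha p hn]

theorem inner_eq_tsum_fourierCoeff (f g : L2) :
    HasSum (fun n : ℤ => conj (fourierCoeff f n) * fourierCoeff g n) ⟪f, g⟫_ℂ := by
  have e : (fun n : ℤ => conj (fourierCoeff f n) * fourierCoeff g n) =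
      fun n => ⟪f, fourierBasis n⟫_ℂ * ⟪(fourierBasis n : L2), g⟫_ℂ := funext fun n => by
    rw [← fourierBasis_repr, ← fourierBasis_repr, HilbertBasis.repr_apply_apply,
      HilbertBasis.repr_apply_apply, inner_conj_symm]
  rw [e]
  exact fourierBasis.hasSum_inner_mul_inner f g

/-- Against `α h`, the factor `α` moves to the other side: `p / den` is replaced by the conjugate of
an analytic function vanishing at `0`. That conjugate has only negative frequencies, while `h` has
none. -/
theorem toL2_ratFun_mem_K (ha : ∀ i, ‖a i‖ < 1)
    (hα : ∀ z, α z = c * ((blaschkeNum a).eval z / (blaschkeDen a).eval z))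
    {p : ℂ[X]} (hp : p.degree < m) : toL2 (ratFun ha p) ∈ K α := by
  refine ⟨toL2_ratFun_mem_hardy ha p, ?_⟩
  rw [SetLike.mem_coe, Submodule.mem_orthogonal]
  rintro g ⟨h, hh, hg⟩
  obtain ⟨p', hp'⟩ := exists_blaschke_mul_conj_ratFun ha hα hp
  have h1 : ⟪toL2 (ratFun ha p), g⟫_ℂ = ⟪toL2 (star (ratFun ha (X * p'))), h⟫_ℂ := by
    rw [inner_eq_integral, inner_eq_integral]
    refine integral_congr_ae ?_
    filter_upwards [hg, coeFn_toL2 (ratFun ha p), coeFn_toL2 (star (ratFun ha (X * p')))] with t e1 e2 e3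
    rw [e1, e2, e3, ContinuousMap.star_apply, ← starRingEnd_apply, Complex.conj_conj, ← hp']
    ring
  rw [inner_eq_zero_symm, h1]
  refine (inner_eq_tsum_fourierCoeff _ _).unique ?_
  convert hasSum_zero using 2 with n
  rcases lt_or_ge n 0 with hn | hn
  · rw [hh n hn, mul_zero]
  · have : fourierCoeff (toL2 (star (ratFun ha (X * p')))) n = 0 := by
      rw [fourierCoeff_congr_ae (coeFn_toL2 _)]
      have := integral_ratFun ha (X ^ n.toNat * (X * p'))
      simp only [eval_mul, eval_X, zero_mul, mul_zero] at this
      rw [← map_eq_zero (starRingEnd ℂ), fourierCoeff, ← integral_conj, ← this]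
      refine integral_congr_ae (.of_forall fun t => ?_)
      simp only [fourier_neg, smul_eq_mul, map_mul, ContinuousMap.star_apply, Complex.conj_conj,
        RCLike.star_def]
      simp only [fourier_eq_pt_zpow, ratFun_apply, eval_mul, eval_pow, eval_X, ← zpow_natCast,
        Int.toNat_of_nonneg hn, mul_div_assoc]
    rw [this, map_zero, zero_mul]

end Blaschke

/-! ### Every element of the model space is a fraction `p / den` -/

section Blaschke

variable {m : ℕ} {α : ℂ → ℂ} {c : Circle} {a : Fin m → ℂ}

theorem memLp_continuous_mul (g : C(T, ℂ)) (f : L2) :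
    MemLp (fun t => g t * f t) 2 (haarAddCircle : Measure T) := by
  refine MemLp.mul (p := ⊤) (q := 2) (Lp.memLp f) ?_
  exact memLp_top_of_bound g.continuous.aestronglyMeasurable ‖g‖
    (.of_forall fun t => g.norm_coe_le_norm t)

/-- The restriction of a polynomial to the circle. -/
noncomputable def polyFun (p : ℂ[X]) : C(T, ℂ) := ⟨fun t => p.eval (pt t), p.continuous.comp continuous_pt⟩

theorem polyFun_apply (p : ℂ[X]) (t : T) : polyFun p t = p.eval (pt t) := rfl

theorem fourierCoeff_eval_mul_eq_zero (p : ℂ[X]) {f : L2} (hf : f ∈ hardy) {n : ℤ} (hn : n < 0) :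
    fourierCoeff (fun t => p.eval (pt t) * f t) n = 0 := by
  have hint : ∀ k : ℕ, Integrable (fun t => pt t ^ k * f t) (haarAddCircle : Measure T) := fun k => by
    have := memLp_continuous_mul (polyFun (X ^ k)) f
    simp only [polyFun_apply, eval_pow, eval_X] at this
    exact this.integrable (by norm_num)
  have h1 : (fun t => p.eval (pt t) * f t) =
      ∑ k ∈ Finset.range (p.natDegree + 1), fun t => p.coeff k * (pt t ^ k * f t) := by
    ext t
    rw [eval_eq_sum_range, Finset.sum_mul, Finset.sum_apply]
    simp only [mul_assoc]
  rw [h1, fourierCoeff.sum _ _ fun k _ => (hint k).const_mul _, Finset.sum_apply]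
  refine Finset.sum_eq_zero fun k _ => ?_
  rw [fourierCoeff.const_mul]
  have h2 := hf (n - k) (by omega)
  convert mul_zero _
  rw [← h2]
  refine integral_congr_ae (.of_forall fun t => ?_)
  simp only [smul_eq_mul, fourier_eq_pt_zpow]
  rw [← mul_assoc, ← zpow_natCast, ← zpow_add₀ (pt_ne_zero t)]
  congr 2; ring

/-- The product `F = den · f` is a polynomial of degree `< m`. Negative coefficients vanish because
`f ∈ hardy`. The coefficient of index `m + k` is, up to a nonzero constant, the inner product of `f`
with `c z^k num = α z^k den`, which lies in `α H²`. -/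
theorem exists_ratFun_of_mem_K (ha : ∀ i, ‖a i‖ < 1)
    (hα : ∀ z, α z = c * ((blaschkeNum a).eval z / (blaschkeDen a).eval z))
    {f : L2} (hf : f ∈ K α) : ∃ p : ℂ[X], p.degree < m ∧ f = toL2 (ratFun ha p) := by
  obtain ⟨hfH, hfα⟩ := hf
  have hmem := memLp_continuous_mul (polyFun (blaschkeDen a)) f
  set F : L2 := hmem.toLp _ with hF
  have hFae : (F : T → ℂ) =ᵐ[haarAddCircle] fun t => (blaschkeDen a).eval (pt t) * f t :=
    hmem.coeFn_toLp
  have hneg : ∀ n : ℤ, n < 0 → fourierCoeff F n = 0 := fun n hn => by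
    rw [fourierCoeff_congr_ae hFae, fourierCoeff_eval_mul_eq_zero _ hfH hn]
  have hge : ∀ n : ℤ, (m : ℤ) ≤ n → fourierCoeff F n = 0 := fun n hn => by
    obtain ⟨k, rfl⟩ := Int.le.dest hn
    have hg : toL2 (polyFun (C (c : ℂ) * (X ^ k * blaschkeNum a))) ∈ mulHardy α := by
      refine ⟨toL2 (polyFun (X ^ k * blaschkeDen a)), ?_, ?_⟩
      · have := toL2_ratFun_mem_hardy ha (X ^ k * blaschkeDen a * blaschkeDen a)
        convert this using 2
        ext t
        simp only [ratFun_apply, polyFun_apply, eval_mul]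
        rw [mul_div_cancel_right₀ _ (den_pt_ne_zero ha t)]
      · filter_upwards [coeFn_toL2 (polyFun (C (c : ℂ) * (X ^ k * blaschkeNum a))),
          coeFn_toL2 (polyFun (X ^ k * blaschkeDen a))] with t e1 e2
        rw [e1, e2, polyFun_apply, polyFun_apply]
        simp only [eval_mul, eval_C, eval_pow, eval_X]
        linear_combination (-pt t ^ k) * blaschke_mul_den hα (den_pt_ne_zero ha t)
    have h1 := (Submodule.mem_orthogonal _ _).1 hfα _ hg
    rw [inner_eq_integral] at h1
    -- This constant arises from conjugating `c · num = c (-z)^m conj den`.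
    have hc : conj (c : ℂ) * (-1) ^ m ≠ 0 := by simp
    refine (mul_eq_zero.1 (?_ : conj (c : ℂ) * (-1) ^ m * _ = 0)).resolve_left hc
    rw [← h1, fourierCoeff, ← integral_const_mul]
    refine integral_congr_ae ?_
    filter_upwards [coeFn_toL2 (polyFun (C (c : ℂ) * (X ^ k * blaschkeNum a))), hFae] with t e1 e2
    rw [e1, e2, polyFun_apply]
    simp only [eval_mul, eval_C, eval_pow, eval_X, eval_blaschkeNum_pt, fourier_neg, smul_eq_mul,
      fourier_eq_pt_zpow]
    rw [← Nat.cast_add, zpow_natCast, neg_pow]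
    simp only [map_mul, map_pow, Complex.conj_conj, map_neg]
    ring
  set p : ℂ[X] := ∑ k ∈ Finset.range m, C (fourierCoeff F k) * X ^ k with hp
  refine ⟨p, ?_, ?_⟩
  · rw [hp]
    exact mem_degreeLT.1 (Submodule.sum_mem _ fun k hk => mem_degreeLT.2
      ((degree_C_mul_X_pow_le _ _).trans_lt (by exact_mod_cast Finset.mem_range.1 hk)))
  · have hFp : F = ∑ k ∈ Finset.range m, fourierCoeff F k • (fourierBasis (k : ℤ) : L2) := by
      apply fourierBasis.repr.injective
      ext n
      rw [map_sum, fourierBasis_repr]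
      simp only [map_smul, HilbertBasis.repr_self]
      rw [lp.coeFn_sum, Finset.sum_apply]
      simp only [lp.coeFn_smul, Pi.smul_apply, lp.single_apply, smul_eq_mul]
      by_cases hn : 0 ≤ n ∧ n < m
      · obtain ⟨k, rfl⟩ := Int.eq_ofNat_of_zero_le hn.1
        rw [Finset.sum_eq_single k]
        · simp
        · intro j _ hj
          rw [Pi.single_eq_of_ne (by exact_mod_cast hj.symm), mul_zero]
        · intro h; exact absurd (Finset.mem_range.2 (by exact_mod_cast hn.2)) h
      · rw [Finset.sum_eq_zero]
        · rcases lt_or_ge n 0 with h | h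
          · exact hneg n h
          · exact hge n (not_lt.1 fun h' => hn ⟨h, h'⟩)
        · intro k hk
          have := Finset.mem_range.1 hk
          rw [Pi.single_eq_of_ne (by rintro rfl; exact hn ⟨by omega, by omega⟩), mul_zero]
    have hFp' : F = toL2 (polyFun p) := by
      have e : polyFun p = ∑ k ∈ Finset.range m, fourierCoeff F k • (fourier (k : ℤ) : C(T, ℂ)) := by
        ext t
        rw [polyFun_apply, hp, eval_finsetSum, ContinuousMap.sum_apply]
        simp only [eval_mul, eval_C, eval_pow, eval_X, ContinuousMap.smul_apply, smul_eq_mul,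
          fourier_eq_pt_zpow, zpow_natCast]
      rw [e, toL2, map_sum]
      conv_lhs => rw [hFp]
      simp only [map_smul, coe_fourierBasis]
    refine Lp.ext ?_
    filter_upwards [coeFn_toL2 (ratFun ha p), hFae, coeFn_toL2 (polyFun p)] with t e1 e2 e3
    rw [e1, ratFun_apply, eq_div_iff (den_pt_ne_zero ha t), mul_comm, ← e2, hFp', e3, polyFun_apply]

end Blaschke

/-! ### Boundary kernels: reproducing property and norm -/

section Blaschke

variable {m : ℕ} {α : ℂ → ℂ} {c : Circle} {a : Fin m → ℂ}

theorem norm_blaschke_zero_lt_one (hm : 0 < m) (ha : ∀ i, ‖a i‖ < 1)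
    (hα : ∀ z, α z = c * ((blaschkeNum a).eval z / (blaschkeDen a).eval z)) : ‖α 0‖ < 1 := by
  obtain ⟨k, rfl⟩ := Nat.exists_eq_succ_of_ne_zero hm.ne'
  rw [hα, eval_blaschkeDen_zero, div_one, norm_mul, Circle.norm_coe, one_mul, eval_blaschkeNum,
    norm_prod, Fin.prod_univ_succ]
  simp only [sub_zero]
  refine (mul_le_of_le_one_right (norm_nonneg _) ?_).trans_lt (ha 0)
  exact Finset.prod_le_one (fun i _ => norm_nonneg _) fun i _ => (ha _).le

theorem divByMonic_X_sub_C_spec {p : ℂ[X]} (hp : p.natDegree ≤ m) {ξ : ℂ} (h : p.eval ξ = 0) :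
    (p /ₘ (X - C ξ)).degree < m ∧ ∀ z, p.eval z = (z - ξ) * (p /ₘ (X - C ξ)).eval z := by
  constructor
  · by_cases h0 : p = 0
    · rw [h0, zero_divByMonic, degree_zero]; exact WithBot.bot_lt_coe m
    · exact (degree_divByMonic_lt p _ h0 (by rw [degree_X_sub_C]; exact one_pos)).trans_le
        (natDegree_le_iff_degree_le.1 hp)
  · intro z
    conv_lhs => rw [← mul_divByMonic_eq_iff_isRoot.2 h]
    simp

/-- The polynomial whose roots are the points where the Blaschke product takes the value `v`. -/
noncomputable def levelPoly (c : Circle) (a : Fin m → ℂ) (v : ℂ) : ℂ[X] :=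
  blaschkeDen a - C (conj v * c) * blaschkeNum a

theorem natDegree_levelPoly_le (v : ℂ) : (levelPoly c a v).natDegree ≤ m :=
  (natDegree_sub_le _ _).trans (max_le (natDegree_blaschkeDen_le a)
    ((natDegree_C_mul_le _ _).trans (natDegree_blaschkeNum_le a)))

theorem eval_levelPoly (hα : ∀ z, α z = c * ((blaschkeNum a).eval z / (blaschkeDen a).eval z))
    (v : ℂ) {z : ℂ} (hz : (blaschkeDen a).eval z ≠ 0) :
    (levelPoly c a v).eval z = (1 - conj v * α z) * (blaschkeDen a).eval z := by
  simp only [levelPoly, eval_sub, eval_mul, eval_C]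
  linear_combination conj v * blaschke_mul_den hα hz

/-- The numerator of the kernel function `k_ξ` of a finite Blaschke product. -/
noncomputable def kernelPoly (α : ℂ → ℂ) (c : Circle) (a : Fin m → ℂ) (ξ : Circle) : ℂ[X] :=
  C (-(ξ : ℂ)) * (levelPoly c a (α ξ) /ₘ (X - C (ξ : ℂ)))

theorem circle_den_ne_zero (ha : ∀ i, ‖a i‖ < 1) (ξ : Circle) :
    (blaschkeDen a).eval (ξ : ℂ) ≠ 0 := eval_blaschkeDen_ne_zero ha (Circle.norm_coe ξ).le

theorem blaschke_mul_conj_circle (ha : ∀ i, ‖a i‖ < 1)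
    (hα : ∀ z, α z = c * ((blaschkeNum a).eval z / (blaschkeDen a).eval z)) (ξ : Circle) :
    α ξ * conj (α ξ) = 1 := by
  obtain ⟨t, ht⟩ := exists_pt_eq ξ
  rw [← ht, blaschke_mul_conj ha hα]

/-- The level polynomial vanishes at `ξ` since `|α ξ| = 1`. The factor `-ξ` in `kernelPoly` turns
division by `z - ξ` into division by `1 - conj ξ · z = -conj ξ (z - ξ)`. -/
theorem kernelPoly_spec (ha : ∀ i, ‖a i‖ < 1)
    (hα : ∀ z, α z = c * ((blaschkeNum a).eval z / (blaschkeDen a).eval z)) (ξ : Circle) :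
    (kernelPoly α c a ξ).degree < m ∧ ∀ z, (1 - conj (ξ : ℂ) * z) * (kernelPoly α c a ξ).eval z =
      (levelPoly c a (α ξ)).eval z := by
  have h0 : (levelPoly c a (α ξ)).eval (ξ : ℂ) = 0 := by
    rw [eval_levelPoly hα _ (circle_den_ne_zero ha ξ), mul_comm (conj _),
      blaschke_mul_conj_circle ha hα, sub_self, zero_mul]
  obtain ⟨h1, h2⟩ := divByMonic_X_sub_C_spec (natDegree_levelPoly_le (α ξ)) h0
  refine ⟨?_, fun z => ?_⟩
  · rw [kernelPoly, degree_C_mul (neg_ne_zero.2 (Circle.coe_ne_zero ξ))]; exact h1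
  · rw [h2, kernelPoly, eval_mul, eval_C]
    linear_combination (z * (levelPoly c a (α ξ) /ₘ (X - C (ξ : ℂ))).eval z) * circle_mul_conj ξ

theorem ratFun_kernelPoly (ha : ∀ i, ‖a i‖ < 1)
    (hα : ∀ z, α z = c * ((blaschkeNum a).eval z / (blaschkeDen a).eval z)) (ξ : Circle) (t : T) :
    (1 - conj (ξ : ℂ) * pt t) * ratFun ha (kernelPoly α c a ξ) t =
      1 - conj (α ξ) * α (pt t) := by
  rw [ratFun_apply, ← mul_div_assoc, (kernelPoly_spec ha hα ξ).2,
    eval_levelPoly hα _ (den_pt_ne_zero ha t), mul_div_cancel_right₀ _ (den_pt_ne_zero ha t)]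

theorem one_sub_conj_mul_ne_zero {ξ : Circle} {z : ℂ} (h : z ≠ ξ) : 1 - conj (ξ : ℂ) * z ≠ 0 := by
  intro h'
  apply h
  linear_combination (-z) * circle_mul_conj ξ - ξ * h'

theorem kernel_eq_ratFun (ha : ∀ i, ‖a i‖ < 1)
    (hα : ∀ z, α z = c * ((blaschkeNum a).eval z / (blaschkeDen a).eval z)) {ξ : Circle} {t : T}
    (h : pt t ≠ ξ) : kernel α ξ (pt t) = ratFun ha (kernelPoly α c a ξ) t := by
  rw [kernel, ← ratFun_kernelPoly ha hα, mul_div_cancel_left₀ _ (one_sub_conj_mul_ne_zero h)]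

/-- The quotient defining `kernel` takes the junk value `0 / 0 = 0` at `ξ`, so it matches the
continuous fraction only off that null point. -/
theorem kernel_ae_eq (ha : ∀ i, ‖a i‖ < 1)
    (hα : ∀ z, α z = c * ((blaschkeNum a).eval z / (blaschkeDen a).eval z)) (ξ : Circle) :
    (fun t => kernel α ξ (pt t)) =ᵐ[haarAddCircle] ratFun ha (kernelPoly α c a ξ) := by
  filter_upwards [ae_pt_notMem (Set.finite_singleton (ξ : ℂ))] with t ht
  exact kernel_eq_ratFun ha hα ht

theorem eval_zero_kernelPoly (ha : ∀ i, ‖a i‖ < 1)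
    (hα : ∀ z, α z = c * ((blaschkeNum a).eval z / (blaschkeDen a).eval z)) (ξ : Circle) :
    (kernelPoly α c a ξ).eval 0 = 1 - conj (α ξ) * α 0 := by
  have h := (kernelPoly_spec ha hα ξ).2 0
  rwa [eval_levelPoly hα _ (by rw [eval_blaschkeDen_zero]; exact one_ne_zero),
    eval_blaschkeDen_zero, mul_one, mul_zero, sub_zero, one_mul] at h

theorem norm_blaschke_circle (ha : ∀ i, ‖a i‖ < 1)
    (hα : ∀ z, α z = c * ((blaschkeNum a).eval z / (blaschkeDen a).eval z)) (ξ : Circle) :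
    ‖α ξ‖ = 1 := by
  have h := blaschke_mul_conj_circle ha hα ξ
  rw [Complex.mul_conj, Complex.normSq_eq_norm_sq] at h
  have h' : ‖α ξ‖ ^ 2 = 1 := by exact_mod_cast h
  exact (pow_eq_one_iff_of_nonneg (norm_nonneg _) two_ne_zero).1 h'

/-- Its value at `0` is `1 - conj (α ξ) α 0`, and `|α 0| < 1 = |α ξ|`; this is where `m > 0` enters.
-/
theorem kernelPoly_ne_zero (hm : 0 < m) (ha : ∀ i, ‖a i‖ < 1)
    (hα : ∀ z, α z = c * ((blaschkeNum a).eval z / (blaschkeDen a).eval z)) (ξ : Circle) :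
    kernelPoly α c a ξ ≠ 0 := by
  intro h
  have h1 := eval_zero_kernelPoly ha hα ξ
  rw [h, eval_zero, eq_comm, sub_eq_zero] at h1
  have h2 : ‖conj (α ξ) * α 0‖ = 1 := by rw [← h1, norm_one]
  rw [norm_mul, RCLike.norm_conj, norm_blaschke_circle ha hα, one_mul] at h2
  exact (norm_blaschke_zero_lt_one hm ha hα).ne h2

/-- Split `p / den = w + (z - ξ) g` with `w` the value at `ξ`. On the circle `(z - ξ) conj k_ξ = z
(1 - α(ξ) conj α)`, which removes the denominator of the kernel. What remains are mean values and
integrals of elements of `K α` against `conj α`, the latter being zero. -/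
theorem integral_ratFun_mul_conj_kernelPoly (ha : ∀ i, ‖a i‖ < 1)
    (hα : ∀ z, α z = c * ((blaschkeNum a).eval z / (blaschkeDen a).eval z)) (ξ : Circle)
    {p : ℂ[X]} (hp : p.degree < m) :
    ∫ t, ratFun ha p t * conj (ratFun ha (kernelPoly α c a ξ) t) ∂(haarAddCircle : Measure T) =
      p.eval (ξ : ℂ) / (blaschkeDen a).eval (ξ : ℂ) := by
  set w := p.eval (ξ : ℂ) / (blaschkeDen a).eval (ξ : ℂ) with hw
  have hdeg : (p - C w * blaschkeDen a).natDegree ≤ m :=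
    (natDegree_sub_le _ _).trans (max_le (natDegree_le_iff_degree_le.2 hp.le)
      ((natDegree_C_mul_le _ _).trans (natDegree_blaschkeDen_le a)))
  have hroot : (p - C w * blaschkeDen a).eval (ξ : ℂ) = 0 := by
    simp only [eval_sub, eval_mul, eval_C]
    rw [hw, div_mul_cancel₀ _ (circle_den_ne_zero ha ξ), sub_self]
  obtain ⟨hg, hgz⟩ := divByMonic_X_sub_C_spec hdeg hroot
  set g := (p - C w * blaschkeDen a) /ₘ (X - C (ξ : ℂ))
  have hf : ∀ t, ratFun ha p t = w + (pt t - ξ) * ratFun ha g t := fun t => by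
    have h := hgz (pt t)
    simp only [eval_sub, eval_mul, eval_C] at h
    rw [ratFun_apply, ratFun_apply]
    field_simp [den_pt_ne_zero ha t]
    linear_combination h
  have hα' := continuous_blaschke_pt ha hα
  have hcα : Continuous fun t => conj (α (pt t)) := Complex.continuous_conj.comp hα'
  -- The integral of `z g conj α` is not zero by itself, since `z g` may leave `K α`; substituting
  -- `z g = p / den - w + ξ g` splits it into integrals already known.
  have key : ∀ t, ratFun ha p t * conj (ratFun ha (kernelPoly α c a ξ) t) =
      ratFun ha (X * g) t - α ξ * (ratFun ha p t * conj (α (pt t)))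
        + (α ξ * w) * conj (α (pt t)) - (α ξ * ξ) * (ratFun ha g t * conj (α (pt t)))
        + w * conj (ratFun ha (kernelPoly α c a ξ) t) := fun t => by
    have h1 := congrArg conj (ratFun_kernelPoly ha hα ξ t)
    simp only [map_sub, map_one, map_mul, Complex.conj_conj] at h1
    have h2 := pt_mul_conj t
    have h3 : ratFun ha (X * g) t = pt t * ratFun ha g t := by
      rw [ratFun_apply, ratFun_apply, eval_mul, eval_X, mul_div_assoc]
    rw [h3, hf t]
    linear_combination (pt t * ratFun ha g t) * h1 +
      (ratFun ha g t * ξ * conj (ratFun ha (kernelPoly α c a ξ) t)) * h2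
  have i1 : Integrable (fun t => ratFun ha (X * g) t) (haarAddCircle : Measure T) :=
    integrable_of_continuous (ratFun ha _).continuous
  have i2 : Integrable (fun t => α ξ * (ratFun ha p t * conj (α (pt t))))
      (haarAddCircle : Measure T) :=
    integrable_of_continuous (continuous_const.mul ((ratFun ha _).continuous.mul hcα))
  have i3 : Integrable (fun t => (α ξ * w) * conj (α (pt t))) (haarAddCircle : Measure T) :=
    integrable_of_continuous (continuous_const.mul hcα)
  have i4 : Integrable (fun t => (α ξ * ξ) * (ratFun ha g t * conj (α (pt t))))
      (haarAddCircle : Measure T) :=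
    integrable_of_continuous (continuous_const.mul ((ratFun ha _).continuous.mul hcα))
  have i5 : Integrable (fun t => w * conj (ratFun ha (kernelPoly α c a ξ) t))
      (haarAddCircle : Measure T) :=
    integrable_of_continuous (continuous_const.mul
      (Complex.continuous_conj.comp (ratFun ha _).continuous))
  have j : Integrable (fun t => ratFun ha (X * g) t - α ξ * (ratFun ha p t * conj (α (pt t))))
      (haarAddCircle : Measure T) := i1.sub i2
  have J : Integrable (fun t => ratFun ha (X * g) t - α ξ * (ratFun ha p t * conj (α (pt t)))
      + (α ξ * w) * conj (α (pt t))) (haarAddCircle : Measure T) := j.add i3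
  have J' : Integrable (fun t => ratFun ha (X * g) t - α ξ * (ratFun ha p t * conj (α (pt t)))
      + (α ξ * w) * conj (α (pt t)) - (α ξ * ξ) * (ratFun ha g t * conj (α (pt t))))
      (haarAddCircle : Measure T) := J.sub i4
  have hI : ∫ t, α (pt t) ∂(haarAddCircle : Measure T) = α 0 := by
    have h1 : ∀ t, α (pt t) = c * ratFun ha (blaschkeNum a) t := fun t => hα _
    simp_rw [h1]
    rw [integral_const_mul, integral_ratFun, hα, eval_blaschkeDen_zero, div_one]
  simp_rw [key]
  rw [integral_add J' i5,
    integral_sub J i4, integral_add j i3, integral_sub i1 i2, integral_const_mul, integral_const_mul,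
    integral_const_mul, integral_const_mul, integral_ratFun, integral_conj, integral_conj, hI,
    integral_ratFun, integral_ratFun_mul_conj_blaschke ha hα hp,
    integral_ratFun_mul_conj_blaschke ha hα hg, eval_zero_kernelPoly ha hα]
  simp only [eval_mul, eval_X, map_sub, map_one, map_mul, Complex.conj_conj]
  ring

theorem inner_toL2_kernelPoly (ha : ∀ i, ‖a i‖ < 1)
    (hα : ∀ z, α z = c * ((blaschkeNum a).eval z / (blaschkeDen a).eval z)) (ξ : Circle)
    {p : ℂ[X]} (hp : p.degree < m) :
    ⟪toL2 (ratFun ha (kernelPoly α c a ξ)), toL2 (ratFun ha p)⟫_ℂ =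
      p.eval (ξ : ℂ) / (blaschkeDen a).eval (ξ : ℂ) := by
  rw [← integral_ratFun_mul_conj_kernelPoly ha hα ξ hp]
  exact ContinuousMap.inner_toLp _ _ _

/-- Differentiate `(1 - conj ξ · z) k_ξ(z) = 1 - conj (α ξ) α(z)` at `z = ξ`, where the first factor
vanishes. -/
theorem norm_kernelPoly_div (ha : ∀ i, ‖a i‖ < 1)
    (hα : ∀ z, α z = c * ((blaschkeNum a).eval z / (blaschkeDen a).eval z)) (ξ : Circle) :
    ‖(kernelPoly α c a ξ).eval (ξ : ℂ) / (blaschkeDen a).eval (ξ : ℂ)‖ = ‖deriv α ξ‖ := by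
  have hd : ∀ p : ℂ[X], DifferentiableAt ℂ (fun z => p.eval z) (ξ : ℂ) := fun p =>
    p.differentiable.differentiableAt
  have hαd : DifferentiableAt ℂ α (ξ : ℂ) := by
    have e : α = fun z => (c : ℂ) * ((blaschkeNum a).eval z / (blaschkeDen a).eval z) := funext hα
    rw [e]
    exact ((hd _).fun_div (hd _) (circle_den_ne_zero ha ξ)).const_mul _
  have hk := ((hd (kernelPoly α c a ξ)).fun_div (hd _) (circle_den_ne_zero ha ξ)).hasDerivAt
  have h1 : HasDerivAt (fun z : ℂ => 1 - conj (ξ : ℂ) * z) (-conj (ξ : ℂ)) (ξ : ℂ) := by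
    simpa using ((hasDerivAt_id (ξ : ℂ)).const_mul (conj (ξ : ℂ))).const_sub 1
  have h2 := h1.fun_mul hk
  have h3 := (hαd.hasDerivAt.const_mul (conj (α ξ))).const_sub 1
  have hev : (fun z : ℂ => (1 - conj (ξ : ℂ) * z) *
      ((kernelPoly α c a ξ).eval z / (blaschkeDen a).eval z)) =ᶠ[nhds (ξ : ℂ)]
      fun z => 1 - conj (α ξ) * α z := by
    filter_upwards [((blaschkeDen a).continuous.continuousAt).eventually_ne
      (circle_den_ne_zero ha ξ)] with z hz
    rw [← mul_div_assoc, (kernelPoly_spec ha hα ξ).2, eval_levelPoly hα _ hz,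
      mul_div_cancel_right₀ _ hz]
  have h4 := h2.unique (h3.congr_of_eventuallyEq hev)
  rw [mul_comm (conj (ξ : ℂ)), circle_mul_conj, sub_self, zero_mul, add_zero] at h4
  have h5 := congrArg norm h4
  simpa [norm_blaschke_circle ha hα, Circle.norm_coe] using h5

theorem kernelNorm_eq (ha : ∀ i, ‖a i‖ < 1)
    (hα : ∀ z, α z = c * ((blaschkeNum a).eval z / (blaschkeDen a).eval z)) (ξ : Circle) :
    kernelNorm α ξ = ‖toL2 (ratFun ha (kernelPoly α c a ξ))‖ := by
  rw [kernelNorm, Lp.norm_def, eLpNorm_congr_ae (kernel_ae_eq ha hα ξ),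
    eLpNorm_congr_ae (coeFn_toL2 _)]

theorem kernelNorm_sq (ha : ∀ i, ‖a i‖ < 1)
    (hα : ∀ z, α z = c * ((blaschkeNum a).eval z / (blaschkeDen a).eval z)) (ξ : Circle) :
    kernelNorm α ξ ^ 2 = ‖deriv α ξ‖ := by
  rw [kernelNorm_eq ha hα, ← norm_kernelPoly_div ha hα,
    ← inner_toL2_kernelPoly ha hα ξ (kernelPoly_spec ha hα ξ).1, inner_self_eq_norm_sq_to_K]
  simp

theorem rootDeriv_eq (ha : ∀ i, ‖a i‖ < 1)
    (hα : ∀ z, α z = c * ((blaschkeNum a).eval z / (blaschkeDen a).eval z)) (ξ : Circle) :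
    rootDeriv α ξ = kernelNorm α ξ := by
  rw [rootDeriv, ← kernelNorm_sq ha hα, Real.sqrt_sq (by exact ENNReal.toReal_nonneg)]

theorem toL2_ratFun_eq_zero (ha : ∀ i, ‖a i‖ < 1) {p : ℂ[X]} (h : toL2 (ratFun ha p) = 0) :
    p = 0 := by
  have h1 : ratFun ha p = 0 :=
    ContinuousMap.toLp_injective (haarAddCircle : Measure T) (𝕜 := ℂ) (p := 2)
      (by rw [map_zero]; exact h)
  refine p.eq_zero_of_infinite_isRoot (Set.Infinite.mono (s := Set.range pt) ?_ ?_)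
  · rintro _ ⟨t, rfl⟩
    have h2 := congrArg (fun u : C(T, ℂ) => u t) h1
    simp only [ratFun_apply, ContinuousMap.zero_apply, div_eq_zero_iff] at h2
    exact h2.resolve_right (den_pt_ne_zero ha t)
  · have : Infinite T := by
      refine not_finite_iff_infinite.1 fun hfin => ?_
      have h := Set.finite_univ.measure_zero (haarAddCircle : Measure T)
      rw [measure_univ] at h
      exact one_ne_zero h
    exact Set.infinite_range_of_injective pt_injective

theorem kernelNorm_pos (hm : 0 < m) (ha : ∀ i, ‖a i‖ < 1)
    (hα : ∀ z, α z = c * ((blaschkeNum a).eval z / (blaschkeDen a).eval z)) (ξ : Circle) :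
    0 < kernelNorm α ξ := by
  rw [kernelNorm_eq ha hα, norm_pos_iff]
  exact fun h => kernelPoly_ne_zero hm ha hα ξ (toL2_ratFun_eq_zero ha h)

end Blaschke

/-! ### The unimodular factors -/

theorem phase_ne_zero (μ η : ℂ) : phase μ η ≠ 0 := Complex.exp_ne_zero _

theorem conj_phase (μ η : ℂ) : conj (phase μ η) = (phase μ η)⁻¹ := by
  rw [phase, ← Complex.exp_conj, ← Complex.exp_neg]
  congr 1
  simp only [map_mul, map_neg, map_div₀, map_sub, Complex.conj_I, Complex.conj_ofReal, map_ofNat]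
  ring

theorem norm_phase (μ η : ℂ) : ‖phase μ η‖ = 1 := by
  have h : phase μ η * conj (phase μ η) = 1 := by
    rw [conj_phase, mul_inv_cancel₀ (phase_ne_zero μ η)]
  rw [Complex.mul_conj, Complex.normSq_eq_norm_sq] at h
  have h' : ‖phase μ η‖ ^ 2 = 1 := by exact_mod_cast h
  exact (pow_eq_one_iff_of_nonneg (norm_nonneg _) two_ne_zero).1 h'

theorem exp_arg_circle (ξ : Circle) : Complex.exp (Complex.arg ξ * Complex.I) = ξ := by
  have := Complex.norm_mul_exp_arg_mul_I (ξ : ℂ)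
  rwa [Circle.norm_coe, Complex.ofReal_one, one_mul] at this

/-- Squaring removes the half-angle. Beyond unimodularity, this identity is all that is used about
the choice of arguments. -/
theorem phase_sq_mul (μ η : Circle) : phase μ η ^ 2 * (η : ℂ) = μ := by
  have h : phase μ η ^ 2 * Complex.exp (Complex.arg η * Complex.I) =
      Complex.exp (Complex.arg μ * Complex.I) := by
    rw [phase, ← Complex.exp_nat_mul, ← Complex.exp_add]
    congr 1
    push_cast
    ring
  rwa [exp_arg_circle, exp_arg_circle] at h

/-! ### The modified Clark basis -/

section Blaschke

variable {m : ℕ} {α : ℂ → ℂ} {c : Circle} {a : Fin m → ℂ}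

/-- The continuous representative of the modified normalized kernel function `e_ξ`. -/
noncomputable def clarkRep (α : ℂ → ℂ) (c : Circle) {a : Fin m → ℂ} (ha : ∀ i, ‖a i‖ < 1) (μ ξ : Circle) :
    C(T, ℂ) :=
  (phase μ ξ * (kernelNorm α ξ : ℂ)⁻¹) • ratFun ha (kernelPoly α c a ξ)

theorem toL2_smul (s : ℂ) (g : C(T, ℂ)) : toL2 (s • g) = s • toL2 g := map_smul _ _ _

theorem toL2_clarkRep_ae_eq (ha : ∀ i, ‖a i‖ < 1)
    (hα : ∀ z, α z = c * ((blaschkeNum a).eval z / (blaschkeDen a).eval z)) (μ ξ : Circle) :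
    (toL2 (clarkRep α c ha μ ξ) : T → ℂ) =ᵐ[haarAddCircle] modifiedClarkFun α μ ξ := by
  filter_upwards [coeFn_toL2 (clarkRep α c ha μ ξ), kernel_ae_eq ha hα ξ] with t h1 h2
  rw [h1, clarkRep, ContinuousMap.smul_apply, modifiedClarkFun, clarkFun, h2, smul_eq_mul, mul_assoc]

theorem toL2_clarkRep_mem_K (ha : ∀ i, ‖a i‖ < 1)
    (hα : ∀ z, α z = c * ((blaschkeNum a).eval z / (blaschkeDen a).eval z)) (μ ξ : Circle) :
    toL2 (clarkRep α c ha μ ξ) ∈ K α := by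
  rw [clarkRep, toL2_smul]
  exact (K α).smul_mem _ (toL2_ratFun_mem_K ha hα (kernelPoly_spec ha hα ξ).1)

theorem eval_kernelPoly_eq_zero (ha : ∀ i, ‖a i‖ < 1)
    (hα : ∀ z, α z = c * ((blaschkeNum a).eval z / (blaschkeDen a).eval z)) {ξ ξ' : Circle}
    (hne : ξ' ≠ ξ) (h : α ξ' = α ξ) : (kernelPoly α c a ξ).eval (ξ' : ℂ) = 0 := by
  have h1 := (kernelPoly_spec ha hα ξ).2 ξ'
  rw [eval_levelPoly hα _ (circle_den_ne_zero ha ξ'), h, mul_comm (conj (α ξ)),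
    blaschke_mul_conj_circle ha hα, sub_self, zero_mul] at h1
  exact (mul_eq_zero.1 h1).resolve_left
    (one_sub_conj_mul_ne_zero fun h' => hne (Circle.ext h'))

variable {η : Fin m → Circle} {v : ℂ}

theorem clarkRep_eq_zero (ha : ∀ i, ‖a i‖ < 1)
    (hα : ∀ z, α z = c * ((blaschkeNum a).eval z / (blaschkeDen a).eval z)) (μ : Circle)
    (hinj : Function.Injective η) (hη : ∀ j, α (η j) = v) {i j : Fin m} (hij : i ≠ j) {t : T}
    (ht : pt t = η i) : clarkRep α c ha μ (η j) t = 0 := by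
  rw [clarkRep, ContinuousMap.smul_apply, ratFun_apply, ht,
    eval_kernelPoly_eq_zero ha hα (hinj.ne hij) (by rw [hη, hη]), zero_div, smul_zero]

/-- The numerator has degree `< m` and already vanishes at the `m - 1` other nodes, so one more zero
would make it the zero polynomial. -/
theorem clarkRep_ne_zero (hm : 0 < m) (ha : ∀ i, ‖a i‖ < 1)
    (hα : ∀ z, α z = c * ((blaschkeNum a).eval z / (blaschkeDen a).eval z)) (μ : Circle)
    (hinj : Function.Injective η) (hη : ∀ j, α (η j) = v) {j : Fin m} {t : T}
    (ht : ∀ i, i ≠ j → pt t ≠ η i) : clarkRep α c ha μ (η j) t ≠ 0 := by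
  rw [clarkRep, ContinuousMap.smul_apply, ratFun_apply, smul_eq_mul]
  refine mul_ne_zero (mul_ne_zero (phase_ne_zero _ _) (inv_ne_zero
    (Complex.ofReal_ne_zero.2 (kernelNorm_pos hm ha hα _).ne')))
    (div_ne_zero (fun h => ?_) (den_pt_ne_zero ha t))
  have h0 := kernelPoly_ne_zero hm ha hα (η j)
  refine h0 (eq_zero_of_natDegree_lt_card_of_eval_eq_zero _
    (f := Function.update (fun i => (η i : ℂ)) j (pt t)) ?_ (fun i => ?_) ?_)
  · intro i k hik
    by_cases hi : i = j <;> by_cases hk : k = j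
    · rw [hi, hk]
    · rw [hi, Function.update_self, Function.update_of_ne hk] at hik
      exact absurd hik (ht k hk)
    · rw [hk, Function.update_self, Function.update_of_ne hi] at hik
      exact absurd hik.symm (ht i hi)
    · rw [Function.update_of_ne hk, Function.update_of_ne hi] at hik
      exact hinj (Circle.ext hik)
  · by_cases hi : i = j
    · rw [hi, Function.update_self]; exact h
    · rw [Function.update_of_ne hi]
      exact eval_kernelPoly_eq_zero ha hα (hinj.ne hi) (by rw [hη, hη])
  · rw [Fintype.card_fin]
    exact (natDegree_lt_iff_degree_lt h0).2 (kernelPoly_spec ha hα (η j)).1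

/-- Orthogonality: the reproducing property evaluates one kernel at the node of another, where it
vanishes. Completeness: `p / den` orthogonal to all kernels has `p` of degree `< m` with `m` zeros.
-/
theorem exists_clark_orthonormalBasis (hm : 0 < m) (ha : ∀ i, ‖a i‖ < 1)
    (hα : ∀ z, α z = c * ((blaschkeNum a).eval z / (blaschkeDen a).eval z)) (μ : Circle)
    (hinj : Function.Injective η) (hη : ∀ j, α (η j) = v) :
    ∃ E : OrthonormalBasis (Fin m) ℂ (K α), ∀ j, (E j : L2) = toL2 (clarkRep α c ha μ (η j)) := by
  have hs : ∀ j, phase μ (η j) * (kernelNorm α (η j) : ℂ)⁻¹ ≠ 0 := fun j =>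
    mul_ne_zero (phase_ne_zero _ _) (inv_ne_zero
      (Complex.ofReal_ne_zero.2 (kernelNorm_pos hm ha hα _).ne'))
  set V : Fin m → K α := fun j => ⟨toL2 (clarkRep α c ha μ (η j)), toL2_clarkRep_mem_K ha hα μ (η j)⟩
    with hV
  have hinner : ∀ j (p : ℂ[X]), p.degree < m → ⟪(V j : L2), toL2 (ratFun ha p)⟫_ℂ =
      conj (phase μ (η j) * (kernelNorm α (η j) : ℂ)⁻¹) *
        (p.eval (η j : ℂ) / (blaschkeDen a).eval (η j : ℂ)) := fun j p hp => by
    rw [hV]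
    simp only [clarkRep]
    rw [toL2_smul, inner_smul_left, inner_toL2_kernelPoly ha hα _ hp]
  have hon : Orthonormal ℂ V := by
    refine ⟨fun j => ?_, fun i j hij => ?_⟩
    · change ‖(V j : L2)‖ = 1
      rw [hV]
      simp only [clarkRep]
      rw [toL2_smul, norm_smul, ← kernelNorm_eq ha hα, norm_mul, norm_phase, one_mul, norm_inv,
        Complex.norm_real, Real.norm_of_nonneg (kernelNorm_pos hm ha hα _).le,
        inv_mul_cancel₀ (kernelNorm_pos hm ha hα _).ne']
    · have h1 : (V j : L2) = (phase μ (η j) * (kernelNorm α (η j) : ℂ)⁻¹) •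
          toL2 (ratFun ha (kernelPoly α c a (η j))) := toL2_smul _ _
      change ⟪(V i : L2), (V j : L2)⟫_ℂ = 0
      rw [h1, inner_smul_right, hinner _ _ (kernelPoly_spec ha hα _).1,
        eval_kernelPoly_eq_zero ha hα (hinj.ne hij) (by rw [hη, hη]), zero_div, mul_zero, mul_zero]
  have hsp : (Submodule.span ℂ (Set.range V))ᗮ = ⊥ := by
    rw [Submodule.eq_bot_iff]
    intro f hf
    obtain ⟨p, hp, hfp⟩ := exists_ratFun_of_mem_K ha hα f.2
    have h0 : p = 0 := by
      by_contra hne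
      refine hne (eq_zero_of_natDegree_lt_card_of_eval_eq_zero p (f := fun i => (η i : ℂ))
        (fun i j hij => hinj (Circle.ext hij)) (fun j => ?_) ?_)
      · have h1 := (Submodule.mem_orthogonal _ _).1 hf (V j) (Submodule.subset_span ⟨j, rfl⟩)
        rw [Submodule.coe_inner, hfp, hinner _ _ hp, mul_eq_zero, map_eq_zero, div_eq_zero_iff] at h1
        exact (h1.resolve_left (hs j)).resolve_right (circle_den_ne_zero ha _)
      · rw [Fintype.card_fin]
        exact (natDegree_lt_iff_degree_lt hne).2 hp
    refine Subtype.ext ?_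
    rw [hfp, h0]
    have : ratFun ha 0 = 0 := by ext t; simp [ratFun_apply]
    rw [this]
    exact map_zero _
  exact ⟨OrthonormalBasis.mkOfOrthogonalEqBot hon hsp, fun j => by
    rw [OrthonormalBasis.coe_of_orthogonal_eq_bot_mk]⟩

/-- The right side depends on `ξ` only through `α ξ`, hence is common to all nodes of a level set.
This, and its conjugate analogue below, feed the four-term relation. -/
theorem clarkRep_mul (hm : 0 < m) (ha : ∀ i, ‖a i‖ < 1)
    (hα : ∀ z, α z = c * ((blaschkeNum a).eval z / (blaschkeDen a).eval z)) (μ ξ : Circle) (t : T) :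
    (phase μ ξ * rootDeriv α ξ) * (ξ - pt t) * clarkRep α c ha μ ξ t =
      μ * (1 - conj (α ξ) * α (pt t)) := by
  have h0 : (kernelNorm α ξ : ℂ) ≠ 0 := Complex.ofReal_ne_zero.2 (kernelNorm_pos hm ha hα _).ne'
  rw [rootDeriv_eq ha hα, clarkRep, ContinuousMap.smul_apply, smul_eq_mul,
    ← ratFun_kernelPoly ha hα]
  field_simp
  have h1 := phase_sq_mul μ ξ
  have h2 := circle_mul_conj ξ
  linear_combination (1 - conj (ξ : ℂ) * pt t) * ratFun ha (kernelPoly α c a ξ) t * h1 +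
    phase μ ξ ^ 2 * pt t * ratFun ha (kernelPoly α c a ξ) t * h2

theorem conj_clarkRep_mul (hm : 0 < m) (ha : ∀ i, ‖a i‖ < 1)
    (hα : ∀ z, α z = c * ((blaschkeNum a).eval z / (blaschkeDen a).eval z)) (μ ξ : Circle) (t : T) :
    (phase μ ξ * rootDeriv α ξ) * (ξ - pt t) * conj (clarkRep α c ha μ ξ t) =
      - pt t * (1 - α ξ * conj (α (pt t))) := by
  have h := congrArg conj (clarkRep_mul hm ha hα μ ξ t)
  simp only [map_mul, map_sub, conj_phase, map_one, Complex.conj_conj] at h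
  have h1 : conj (rootDeriv α ξ) = rootDeriv α ξ := Complex.conj_ofReal _
  rw [h1] at h
  have h2 := phase_sq_mul μ ξ
  have h3 := circle_mul_conj ξ
  have h4 := circle_mul_conj μ
  have h5 := pt_mul_conj t
  have h6 := phase_ne_zero μ ξ
  have h7 : phase μ ξ * rootDeriv α ξ * (ξ - pt t) = - (phase μ ξ) ^ 2 * ξ * pt t *
      ((phase μ ξ)⁻¹ * rootDeriv α ξ * (conj (ξ : ℂ) - conj (pt t))) := by
    field_simp
    linear_combination (rootDeriv α ξ * pt t) * h3 - rootDeriv α ξ * ξ * h5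
  rw [h7, mul_assoc, h]
  linear_combination (-pt t * conj (μ : ℂ) * (1 - α ξ * conj (α (pt t)))) * h2 -
    (pt t * (1 - α ξ * conj (α (pt t)))) * h4

theorem modelConj_clarkRep (hm : 0 < m) (ha : ∀ i, ‖a i‖ < 1)
    (hα : ∀ z, α z = c * ((blaschkeNum a).eval z / (blaschkeDen a).eval z)) {μ ξ : Circle}
    (hμ : (μ : ℂ) = α ξ) :
    modelConj α (toL2 (clarkRep α c ha μ ξ)) =ᵐ[haarAddCircle]
      (toL2 (clarkRep α c ha μ ξ) : T → ℂ) := by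
  filter_upwards [coeFn_toL2 (clarkRep α c ha μ ξ), ae_pt_notMem (Set.finite_singleton (ξ : ℂ))]
    with t h1 h2
  rw [modelConj, h1]
  have h0 : phase μ ξ * rootDeriv α ξ * (ξ - pt t) ≠ 0 := by
    rw [rootDeriv_eq ha hα]
    exact mul_ne_zero (mul_ne_zero (phase_ne_zero _ _)
      (Complex.ofReal_ne_zero.2 (kernelNorm_pos hm ha hα _).ne')) (sub_ne_zero.2 fun h => h2 h.symm)
  -- After multiplication by `ω √|α'(ξ)| (ξ - z)`, both sides become `α(ξ) - α(z)`.
  refine mul_left_cancel₀ h0 ?_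
  have h3 := conj_clarkRep_mul hm ha hα μ ξ t
  have h4 := pt_mul_conj t
  have h5 := blaschke_mul_conj ha hα t
  have h6 := blaschke_mul_conj_circle ha hα ξ
  rw [clarkRep_mul hm ha hα, hμ]
  rw [hμ] at h3
  linear_combination (α (pt t) * conj (pt t)) * h3 - (α (pt t) - α ξ) * h4 +
    (α ξ * (pt t * conj (pt t))) * h5 + (α (pt t)) * h6

end Blaschke

/-! ### Truncated Toeplitz operators as matrices of moments -/

theorem memLp_mul_of_ae_eq (φ : L2) {f : T → ℂ} {g : C(T, ℂ)} (h : f =ᵐ[haarAddCircle] g) :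
    MemLp (fun t => φ t * f t) 2 (haarAddCircle : Measure T) := by
  refine (memLp_continuous_mul g φ).ae_eq ?_
  filter_upwards [h] with t ht
  rw [ht, mul_comm]

/-- An operator between model spaces consisting of continuous functions is a truncated Toeplitz
operator if and only if its matrix entries are the integrals of the products of the basis functions
against some symbol. -/
theorem mem_toeplitzClass_iff {α β : ℂ → ℂ} {m n : ℕ}
    (hcont : ∀ f : K α, ∃ g : C(T, ℂ), (f : L2) = toL2 g)
    (E : OrthonormalBasis (Fin m) ℂ (K α)) (F : OrthonormalBasis (Fin n) ℂ (K β))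
    {e : Fin m → C(T, ℂ)} {f : Fin n → C(T, ℂ)} (hE : ∀ j, (E j : L2) = toL2 (e j))
    (hF : ∀ j, (F j : L2) = toL2 (f j)) (A : K α →ₗ[ℂ] K β) :
    A ∈ toeplitzClass α β ↔ ∃ φ : L2, ∀ s p, LinearMap.toMatrix E.toBasis F.toBasis A s p =
      ∫ t, φ t * (e p t * conj (f s t)) ∂(haarAddCircle : Measure T) := by
  have hmem : ∀ (φ : L2) (u : K α),
      MemLp (fun t => φ t * (u : L2) t) 2 (haarAddCircle : Measure T) := fun φ u => by
    obtain ⟨g, hg⟩ := hcont u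
    refine memLp_mul_of_ae_eq φ (g := g) ?_
    rw [hg]; exact coeFn_toL2 g
  have hentry : ∀ s p, LinearMap.toMatrix E.toBasis F.toBasis A s p = ⟪F s, A (E p)⟫_ℂ :=
    fun s p => by
      rw [LinearMap.toMatrix_apply, OrthonormalBasis.coe_toBasis,
        OrthonormalBasis.coe_toBasis_repr_apply, OrthonormalBasis.repr_apply_apply]
  have hproj : ∀ (φ : L2) s p,
      ⟪F s, (K β).orthogonalProjectionOnto ((hmem φ (E p)).toLp _)⟫_ℂ =
        ∫ t, φ t * (e p t * conj (f s t)) ∂(haarAddCircle : Measure T) := fun φ s p => by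
    rw [Submodule.inner_orthogonalProjectionOnto_eq_of_mem_left, inner_eq_integral]
    refine integral_congr_ae ?_
    filter_upwards [(hmem φ (E p)).coeFn_toLp, (hE p) ▸ coeFn_toL2 (e p),
      (hF s) ▸ coeFn_toL2 (f s)] with t h1 h2 h3
    rw [h1, h2, h3, mul_assoc]
  constructor
  · rintro ⟨-, φ, hφ⟩
    refine ⟨φ, fun s p => ?_⟩
    obtain ⟨h, hA⟩ := hφ (E p)
    rw [hentry, hA, ← hproj φ s p]
  · rintro ⟨φ, hφ⟩
    have : FiniteDimensional ℂ (K α) := E.toBasis.finiteDimensional_of_finite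
    refine ⟨A.continuous_of_finiteDimensional, φ, ?_⟩
    -- The operator with symbol `φ`; it has the same matrix as `A`, so the two coincide.
    let B : K α →ₗ[ℂ] K β :=
      { toFun := fun u => (K β).orthogonalProjectionOnto ((hmem φ u).toLp _)
        map_add' := fun u v => by
          rw [← map_add, ← MemLp.toLp_add]
          congr 1
          refine MemLp.toLp_congr _ _ ?_
          filter_upwards [Lp.coeFn_add (u : L2) (v : L2)] with t ht
          rw [Submodule.coe_add, ht]
          simp only [Pi.add_apply]
          ring
        map_smul' := fun r u => by
          rw [RingHom.id_apply, ← map_smul, ← MemLp.toLp_const_smul]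
          congr 1
          refine MemLp.toLp_congr _ _ ?_
          filter_upwards [Lp.coeFn_smul r (u : L2)] with t ht
          rw [Submodule.coe_smul, ht]
          simp only [Pi.smul_apply, smul_eq_mul]
          ring }
    have hAB : A = B := by
      refine E.toBasis.ext fun p => F.toBasis.ext_elem fun s => ?_
      rw [OrthonormalBasis.coe_toBasis, OrthonormalBasis.coe_toBasis_repr_apply,
        OrthonormalBasis.coe_toBasis_repr_apply, OrthonormalBasis.repr_apply_apply,
        OrthonormalBasis.repr_apply_apply, ← hentry, hφ]
      exact (hproj φ s p).symm
    exact fun u => ⟨hmem φ u, by rw [hAB]; rfl⟩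

/-! ### The four-term relation and prescribed entries -/

section FourPoint

variable {m n : ℕ} {x : Fin m → ℂ} {y : Fin n → ℂ} {a : Fin m → ℂ} {b : Fin n → ℂ}
  {e : Fin m → C(T, ℂ)} {f : Fin n → C(T, ℂ)} {G H : T → ℂ}

/-- Products of functions with simple poles satisfy a four-term relation, and so do their integrals
against any symbol. -/
theorem integral_four_term (he : ∀ p t, a p * (x p - pt t) * e p t = G t)
    (hf : ∀ s t, b s * (y s - pt t) * conj (f s t) = H t) (φ : L2) (s s' : Fin n) (p p' : Fin m) :
    a p * b s * (x p - y s) * ∫ t, φ t * (e p t * conj (f s t)) ∂(haarAddCircle : Measure T)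
      - a p' * b s * (x p' - y s) * ∫ t, φ t * (e p' t * conj (f s t)) ∂(haarAddCircle : Measure T)
      - a p * b s' * (x p - y s') * ∫ t, φ t * (e p t * conj (f s' t)) ∂(haarAddCircle : Measure T)
      + a p' * b s' * (x p' - y s') *
        ∫ t, φ t * (e p' t * conj (f s' t)) ∂(haarAddCircle : Measure T) = 0 := by
  have hI : ∀ (p : Fin m) (s : Fin n) (r : ℂ), Integrable (fun t => r * (φ t * (e p t * conj (f s t))))
      (haarAddCircle : Measure T) := fun p s r => by
    refine Integrable.const_mul ?_ r
    refine ((memLp_continuous_mul (e p * star (f s)) φ).integrable (by norm_num)).congr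
      (.of_forall fun t => ?_)
    simp [mul_comm]
  simp_rw [← integral_const_mul]
  have hI' : ∀ (p p' : Fin m) (s s' : Fin n) (r r' : ℂ),
      Integrable (fun t => r * (φ t * (e p t * conj (f s t))) - r' * (φ t * (e p' t * conj (f s' t))))
        (haarAddCircle : Measure T) := fun p p' s s' r r' => (hI p s r).sub (hI p' s' r')
  rw [sub_add, ← integral_sub (hI _ _ _) (hI _ _ _), ← integral_sub (hI _ _ _) (hI _ _ _),
    ← integral_sub (hI' _ _ _ _ _ _) (hI' _ _ _ _ _ _)]
  refine integral_eq_zero_of_ae ?_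
  filter_upwards [ae_pt_notMem (Set.toFinite {x p, x p', y s, y s'})] with t ht
  simp only [Set.mem_insert_iff, Set.mem_singleton_iff, not_or] at ht
  obtain ⟨h1, h2, h3, h4⟩ := ht
  have hE : ∀ q, pt t ≠ x q → a q * e q t = G t / (x q - pt t) := fun q hq => by
    rw [eq_div_iff (sub_ne_zero.2 hq.symm), ← he q t]; ring
  have hFd : ∀ r, pt t ≠ y r → b r * conj (f r t) = H t / (y r - pt t) := fun r hr => by
    rw [eq_div_iff (sub_ne_zero.2 hr.symm), ← hf r t]; ring
  -- Partial fractions for `(x - y) / ((x - z)(y - z))`: a term in `r` minus a term in `q`, which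
  -- cancels in alternating sums. It remains valid when `x q = y r`, both sides being zero.
  have key : ∀ q r, pt t ≠ x q → pt t ≠ y r →
      a q * b r * (x q - y r) * (φ t * (e q t * conj (f r t))) =
        φ t * G t * H t * (1 / (y r - pt t) - 1 / (x q - pt t)) := fun q r hq hr => by
    have e1 : a q * b r * (x q - y r) * (φ t * (e q t * conj (f r t))) =
        φ t * (x q - y r) * (a q * e q t) * (b r * conj (f r t)) := by ring
    rw [e1, hE q hq, hFd r hr]
    have := sub_ne_zero.2 hq.symm
    have := sub_ne_zero.2 hr.symm
    field_simp
    ring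
  simp only [Pi.zero_apply]
  rw [key p s h1 h3, key p' s h2 h3, key p s' h1 h4, key p' s' h2 h4]
  ring

/-- A symbol can be prescribed on any set of matrix positions whose product functions are linearly
independent. -/
theorem exists_symbol (P : Fin n → Fin m → Prop)
    (hP : ∀ d : Fin n → Fin m → ℂ, (∀ s p, ¬ P s p → d s p = 0) →
      (∀ t, ∑ s, ∑ p, d s p * (e p t * conj (f s t)) = 0) → ∀ s p, d s p = 0)
    (c : Fin n → Fin m → ℂ) : ∃ φ : L2, ∀ s p, P s p →
      ∫ t, φ t * (e p t * conj (f s t)) ∂(haarAddCircle : Measure T) = c s p := by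
  classical
  obtain ⟨φ, hφ⟩ := exists_integral_mul_eq
    (fun i : {i : Fin n × Fin m // P i.1 i.2} => e i.1.2 * star (f i.1.1)) (fun d hd => by
      have h := hP (fun s p => if h : P s p then d ⟨(s, p), h⟩ else 0)
        (fun s p hsp => by simp [hsp]) (fun t => by
          refine Eq.trans ?_ (hd t)
          rw [← Fintype.sum_prod_type' (f := fun s p =>
            (if h : P s p then d ⟨(s, p), h⟩ else 0) * (e p t * conj (f s t))),
            ← Fintype.sum_subtype_add_sum_subtype (fun i : Fin n × Fin m => P i.1 i.2),
            Finset.sum_eq_zero (s := (Finset.univ : Finset {i : Fin n × Fin m // ¬ P i.1 i.2}))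
              fun i _ => by rw [dif_neg i.2, zero_mul], add_zero]
          refine Finset.sum_congr rfl fun i _ => ?_
          rw [dif_pos i.2]
          rfl)
      rintro ⟨⟨s, p⟩, hsp⟩
      simpa [hsp] using h s p) (fun i => c i.1.1 i.1.2)
  refine ⟨φ, fun s p hsp => ?_⟩
  rw [← hφ ⟨(s, p), hsp⟩]
  rfl

end FourPoint

/-! ### Positions that determine the matrix -/

section Realizable

variable {m n : ℕ} {x : Fin m → ℂ} {y : Fin n → ℂ} {a : Fin m → ℂ} {b : Fin n → ℂ}
  {e : Fin m → C(T, ℂ)} {f : Fin n → C(T, ℂ)} {G H : T → ℂ}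

theorem coeff_eq_zero_of_isolated {d : Fin n → Fin m → ℂ} {t : T}
    (hd : ∑ s, ∑ p, d s p * (e p t * conj (f s t)) = 0) {s₀ : Fin n} {p₀ : Fin m}
    (h : ∀ s p, d s p ≠ 0 → e p t ≠ 0 → f s t ≠ 0 → s = s₀ ∧ p = p₀)
    (he : e p₀ t ≠ 0) (hf : f s₀ t ≠ 0) : d s₀ p₀ = 0 := by
  have h0 : ∀ s p, ¬ (s = s₀ ∧ p = p₀) → d s p * (e p t * conj (f s t)) = 0 := fun s p hsp => by
    by_contra hne
    simp only [mul_eq_zero, map_eq_zero, not_or] at hne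
    exact hsp (h s p hne.1 hne.2.1 hne.2.2)
  rw [Finset.sum_eq_single s₀ (fun s _ hs => Finset.sum_eq_zero fun p _ => h0 s p fun h => hs h.1)
    (fun h => absurd (Finset.mem_univ _) h),
    Finset.sum_eq_single p₀ (fun p _ hp => h0 s₀ p fun h => hp h.2)
    (fun h => absurd (Finset.mem_univ _) h)] at hd
  exact (mul_eq_zero.1 hd).resolve_right (mul_ne_zero he (by rwa [Ne, map_eq_zero]))

/-- The matrix positions whose entries determine a truncated Toeplitz operator. -/
def IsFreePosition (l : ℕ) (s : Fin n) (p : Fin m) : Prop :=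
  (s : ℕ) = 0 ∨ ((p : ℕ) = 0 ∧ l ≤ s) ∨ ((s : ℕ) = p ∧ (s : ℕ) < l)

/-- Evaluating at `y s` leaves only row `s`. For `0 < s < l` its sole free position is the diagonal
one, and `y s = x s` lies off the zeros of `e s`; for `s ≥ l` it is column `0`, and `y s` is no node
`x p`. Once these rows are gone, `conj (f 0)` is divided out of the first row and the rest is
evaluated at each `x p`. -/
theorem coeff_eq_zero_of_isFreePosition {l : ℕ}
    (hx : ∀ p, ∃ t, pt t = x p) (hy : ∀ s, ∃ t, pt t = y s) (hxi : Function.Injective x)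
    (hyi : Function.Injective y)
    (he0 : ∀ i j t, i ≠ j → pt t = x i → e j t = 0)
    (he1 : ∀ j t, (∀ i, i ≠ j → pt t ≠ x i) → e j t ≠ 0)
    (hf0 : ∀ i j t, i ≠ j → pt t = y i → f j t = 0)
    (hf1 : ∀ j t, (∀ i, i ≠ j → pt t ≠ y i) → f j t ≠ 0)
    (hxy : ∀ (j : ℕ) (hjm : j < m) (hjn : j < n), j < l → x ⟨j, hjm⟩ = y ⟨j, hjn⟩)
    (hne : ∀ s : Fin n, l ≤ s → ∀ p, x p ≠ y s)
    {d : Fin n → Fin m → ℂ} (hd0 : ∀ s p, ¬ IsFreePosition l s p → d s p = 0)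
    (hd : ∀ t, ∑ s, ∑ p, d s p * (e p t * conj (f s t)) = 0) (s : Fin n) (p : Fin m) :
    d s p = 0 := by
  have hfy : ∀ s t, pt t = y s → f s t ≠ 0 := fun s t ht =>
    hf1 s t fun i hi h => hi (hyi (h.symm.trans ht))
  have hex : ∀ p t, pt t = x p → e p t ≠ 0 := fun p t ht =>
    he1 p t fun i hi h => hi (hxi (h.symm.trans ht))
  have hrow : ∀ (s : Fin n) (p : Fin m), (s : ℕ) ≠ 0 → d s p = 0 := by
    intro s p hs
    by_contra hsp
    rcases (not_imp_comm.1 (hd0 s p) hsp) with h | ⟨hp, hls⟩ | ⟨h, hsl⟩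
    · exact hs h
    · obtain ⟨t, ht⟩ := hy s
      refine hsp (coeff_eq_zero_of_isolated (hd t) (fun s' p' h1 h2 h3 => ?_)
        (he1 p t fun i _ h => hne s hls i (h.symm.trans ht)) (hfy s t ht))
      have hs' : s' = s := by
        by_contra h
        exact h3 (hf0 s s' t (Ne.symm h) ht)
      refine ⟨hs', Fin.ext ?_⟩
      subst hs'
      rcases (not_imp_comm.1 (hd0 s' p') h1) with h | h | h
      · exact absurd h hs
      · rw [h.1, hp]
      · omega
    · obtain ⟨t, ht⟩ := hy s
      have ht' : pt t = x p := by
        rw [ht]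
        have h2 := hxy s (h ▸ p.2) s.2 hsl
        rw [Fin.eta] at h2
        rw [← h2]
        congr 1
        exact Fin.ext h
      refine hsp (coeff_eq_zero_of_isolated (hd t) (fun s' p' h1 h2 h3 => ⟨?_, ?_⟩)
        (hex p t ht') (hfy s t ht))
      · by_contra h
        exact h3 (hf0 s s' t (Ne.symm h) ht)
      · by_contra h
        exact h2 (he0 p p' t (Ne.symm h) ht')
  by_cases hs : (s : ℕ) = 0
  swap
  · exact hrow s p hs
  -- Division by `conj (f s)` is possible off the finite set of nodes `y`; continuity recovers the
  -- identity at every point.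
  have hsum : (fun t => ∑ p, d s p * e p t) = 0 := by
    refine eq_zero_of_ae_eq_zero (continuous_finsetSum _ fun p _ =>
      continuous_const.mul (e p).continuous) ?_
    filter_upwards [ae_pt_notMem (Set.finite_range y)] with t ht
    have h1 := hd t
    rw [Finset.sum_eq_single s (fun s' _ hs' => Finset.sum_eq_zero fun p _ => by
      rw [hrow s' p fun h => hs' (Fin.ext (h.trans hs.symm)), zero_mul])
      (fun h => absurd (Finset.mem_univ _) h)] at h1
    simp only [← mul_assoc] at h1
    rw [← Finset.sum_mul, mul_eq_zero, map_eq_zero] at h1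
    exact h1.resolve_right (hf1 s t fun i _ h => ht ⟨i, h.symm⟩)
  obtain ⟨t, ht⟩ := hx p
  have h1 := congrFun hsum t
  simp only [Pi.zero_apply] at h1
  rw [Finset.sum_eq_single p (fun p' _ hp' => by rw [he0 p p' t (Ne.symm hp') ht, mul_zero])
    (fun h => absurd (Finset.mem_univ _) h)] at h1
  exact (mul_eq_zero.1 h1).resolve_right (hex p t ht)

/-- Necessity is the four-term relation. For sufficiency, a symbol fitted on the free positions
obeys that relation too, and dividing by the nonzero weight `a p * b s * (x p - y s)` forces the
other entries. -/
theorem exists_symbol_iff {l : ℕ} (hm : 0 < m) (hn : 0 < n) (hlm : l ≤ m)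
    (hx : ∀ p, ∃ t, pt t = x p) (hy : ∀ s, ∃ t, pt t = y s) (hxi : Function.Injective x)
    (hyi : Function.Injective y) (ha : ∀ p, a p ≠ 0) (hb : ∀ s, b s ≠ 0)
    (he0 : ∀ i j t, i ≠ j → pt t = x i → e j t = 0)
    (he1 : ∀ j t, (∀ i, i ≠ j → pt t ≠ x i) → e j t ≠ 0)
    (hf0 : ∀ i j t, i ≠ j → pt t = y i → f j t = 0)
    (hf1 : ∀ j t, (∀ i, i ≠ j → pt t ≠ y i) → f j t ≠ 0)
    (he : ∀ p t, a p * (x p - pt t) * e p t = G t)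
    (hf : ∀ s t, b s * (y s - pt t) * conj (f s t) = H t)
    (hxy : ∀ (j : ℕ) (hjm : j < m) (hjn : j < n), j < l → x ⟨j, hjm⟩ = y ⟨j, hjn⟩)
    (hne : ∀ s : Fin n, l ≤ s → ∀ p, x p ≠ y s) (M : Fin n → Fin m → ℂ) :
    (∃ φ : L2, ∀ s p, M s p =
        ∫ t, φ t * (e p t * conj (f s t)) ∂(haarAddCircle : Measure T)) ↔
      (∀ (p : Fin m) (s : ℕ) (hsm : s < m) (hsn : s < n), s < l → s ≠ (p : ℕ) →
        a p * b ⟨s, hsn⟩ * (x p - y ⟨s, hsn⟩) * M ⟨s, hsn⟩ p =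
          a p * b ⟨0, hn⟩ * (x p - y ⟨0, hn⟩) * M ⟨0, hn⟩ p
          - a ⟨s, hsm⟩ * b ⟨0, hn⟩ * (x ⟨s, hsm⟩ - y ⟨0, hn⟩) * M ⟨0, hn⟩ ⟨s, hsm⟩) ∧
      (∀ (p : Fin m) (s : Fin n), l ≤ s →
        a p * b s * (x p - y s) * M s p =
          a ⟨0, hm⟩ * b s * (x ⟨0, hm⟩ - y s) * M s ⟨0, hm⟩
          - a ⟨0, hm⟩ * b ⟨0, hn⟩ * (x ⟨0, hm⟩ - y ⟨0, hn⟩) * M ⟨0, hn⟩ ⟨0, hm⟩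
          + a p * b ⟨0, hn⟩ * (x p - y ⟨0, hn⟩) * M ⟨0, hn⟩ p) := by
  have hfour := integral_four_term he hf
  constructor
  · rintro ⟨φ, hφ⟩
    refine ⟨fun p s hsm hsn hsl _ => ?_, fun p s _ => ?_⟩
    · have h := hfour φ ⟨s, hsn⟩ ⟨0, hn⟩ p ⟨s, hsm⟩
      simp only [← hφ] at h
      rw [hxy s hsm hsn hsl] at h ⊢
      linear_combination h
    · have h := hfour φ s ⟨0, hn⟩ p ⟨0, hm⟩
      simp only [← hφ] at h
      linear_combination h
  · rintro ⟨h1, h2⟩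
    obtain ⟨φ, hφ⟩ := exists_symbol (e := e) (f := f) (IsFreePosition l) (fun d hd0 hd =>
      coeff_eq_zero_of_isFreePosition hx hy hxi hyi he0 he1 hf0 hf1 hxy hne hd0 hd) M
    refine ⟨φ, fun s p => ?_⟩
    by_cases hsp : IsFreePosition l s p
    · exact (hφ s p hsp).symm
    have hs0 : (s : ℕ) ≠ 0 := fun h => hsp (.inl h)
    have hz : ∀ q, ∫ t, φ t * (e q t * conj (f ⟨0, hn⟩ t)) ∂(haarAddCircle : Measure T) =
      M ⟨0, hn⟩ q := fun q => hφ _ _ (.inl rfl)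
    rcases lt_or_ge (s : ℕ) l with hsl | hsl
    · have hne' : (s : ℕ) ≠ p := fun h => hsp (.inr (.inr ⟨h, hsl⟩))
      have hsm : (s : ℕ) < m := hsl.trans_le hlm
      have hxs := hxy s hsm s.2 hsl
      have h3 := h1 p s hsm s.2 hsl hne'
      have h4 := hfour φ s ⟨0, hn⟩ p ⟨s, hsm⟩
      rw [hz, hz] at h4
      rw [hxs] at h3 h4
      simp only [Fin.eta] at h3 h4
      have hw : a p * b s * (x p - y s) ≠ 0 := by
        refine mul_ne_zero (mul_ne_zero (ha p) (hb s)) (sub_ne_zero.2 fun h => hne' ?_)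
        have := hxi (h.trans hxs.symm)
        rw [this]
      refine mul_left_cancel₀ hw ?_
      linear_combination h3 - h4
    · have h3 := h2 p s hsl
      have h4 := hfour φ s ⟨0, hn⟩ p ⟨0, hm⟩
      rw [hz, hz, hφ s ⟨0, hm⟩ (.inr (.inl ⟨rfl, hsl⟩))] at h4
      refine mul_left_cancel₀ (mul_ne_zero (mul_ne_zero (ha p) (hb s))
        (sub_ne_zero.2 (hne s hsl p))) ?_
      linear_combination h3 - h4

end Realizable

/-! ### Common nodes and the stated formulas -/

theorem notMem_range_of_ncard_eq {X : Type*} {m n l : ℕ} {η : Fin m → X} {ζ : Fin n → X}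
    (hη : Function.Injective η) (hζ : Function.Injective ζ)
    (hl : (Set.range η ∩ Set.range ζ).ncard = l)
    (hcommon : ∀ (j : ℕ) (hjm : j < m) (hjn : j < n), j < l → η ⟨j, hjm⟩ = ζ ⟨j, hjn⟩) :
    l ≤ m ∧ ∀ s : Fin n, l ≤ s → ∀ p, η p ≠ ζ s := by
  have hlm : l ≤ m := by
    rw [← hl]
    refine (Set.ncard_le_ncard Set.inter_subset_left (Set.finite_range η)).trans ?_
    rw [← Set.image_univ, Set.ncard_image_of_injective _ hη, Set.ncard_univ, Nat.card_fin]
  have hln : l ≤ n := by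
    rw [← hl]
    refine (Set.ncard_le_ncard Set.inter_subset_right (Set.finite_range ζ)).trans ?_
    rw [← Set.image_univ, Set.ncard_image_of_injective _ hζ, Set.ncard_univ, Nat.card_fin]
  refine ⟨hlm, fun s hs p hps => ?_⟩
  have hinj : Function.Injective fun j : Fin l => ζ (Fin.castLE hln j) :=
    hζ.comp (Fin.castLE_injective hln)
  -- The first `l` coincidences already number `l`, so they exhaust the intersection and no later `ζ
  -- s` can be a node of `α`.
  have hS : Set.range (fun j : Fin l => ζ (Fin.castLE hln j)) = Set.range η ∩ Set.range ζ := by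
    refine Set.eq_of_subset_of_ncard_le ?_ ?_ ((Set.finite_range η).inter_of_left _)
    · rintro _ ⟨j, rfl⟩
      exact ⟨⟨Fin.castLE hlm j, hcommon j _ _ j.2⟩, ⟨_, rfl⟩⟩
    · rw [hl, ← Set.image_univ, Set.ncard_image_of_injective _ hinj, Set.ncard_univ, Nat.card_fin]
  have hmem : ζ s ∈ Set.range fun j : Fin l => ζ (Fin.castLE hln j) := by
    rw [hS]; exact ⟨⟨p, hps⟩, ⟨s, rfl⟩⟩
  obtain ⟨j, hj⟩ := hmem
  have := congrArg Fin.val (hζ hj)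
  simp only [Fin.val_castLE] at this
  omega

/-- Clears denominators; all three displayed formulas are instances, after dropping terms that
vanish. -/
theorem three_term_iff {rp r0 qs q0 up u0 ws w0 xp x0 ys y0 M Ms0 M00 M0p : ℂ}
    (hrp : rp ≠ 0) (hqs : qs ≠ 0) (hup : up ≠ 0) (hws : ws ≠ 0) (hxy : xp - ys ≠ 0) :
    M = r0 / rp * (u0 / up) * ((x0 - ys) / (xp - ys)) * Ms0
        + (r0 * q0) / (rp * qs) * ((u0 * w0) / (up * ws)) * ((y0 - x0) / (xp - ys)) * M00
        + q0 / qs * (w0 / ws) * ((xp - y0) / (xp - ys)) * M0p ↔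
      (up * rp) * (ws * qs) * (xp - ys) * M =
        (u0 * r0) * (ws * qs) * (x0 - ys) * Ms0 - (u0 * r0) * (w0 * q0) * (x0 - y0) * M00
        + (up * rp) * (w0 * q0) * (xp - y0) * M0p := by
  have hw : (up * rp) * (ws * qs) * (xp - ys) ≠ 0 := by simp_all
  rw [mul_comm _ M, ← eq_div_iff hw]
  refine Eq.congr_right ?_
  field_simp
  ring

end ModelSpace

open ModelSpace
theorem theorem3p6 (m n l : ℕ) (hm : 0 < m) (hn : 0 < n) (α β : ℂ → ℂ)
    (hα : IsFiniteBlaschke m α) (hβ : IsFiniteBlaschke n β)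
    (lam₁ lam₂ μ₁ μ₂ : Circle) (η : Fin m → Circle) (ζ : Fin n → Circle)
    (hη_inj : Function.Injective η) (hη : ∀ j, α (η j) = clarkValue α lam₁)
    (hζ_inj : Function.Injective ζ) (hζ : ∀ j, β (ζ j) = clarkValue β lam₂)
    (hl : (Set.range η ∩ Set.range ζ).ncard = l)
    (hcommon : ∀ (j : ℕ) (hjm : j < m) (hjn : j < n), j < l → η ⟨j, hjm⟩ = ζ ⟨j, hjn⟩) :
    ∃ (E : OrthonormalBasis (Fin m) ℂ (K α)) (F : OrthonormalBasis (Fin n) ℂ (K β)),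
      (∀ j, ((E j : L2) : T → ℂ) =ᵐ[haarAddCircle] modifiedClarkFun α μ₁ (η j)) ∧
      (∀ j, ((F j : L2) : T → ℂ) =ᵐ[haarAddCircle] modifiedClarkFun β μ₂ (ζ j)) ∧
      ((μ₁ : ℂ) = clarkValue α lam₁ →
        ∀ j, modelConj α (E j : L2) =ᵐ[haarAddCircle] ((E j : L2) : T → ℂ)) ∧
      ((μ₂ : ℂ) = clarkValue β lam₂ →
        ∀ j, modelConj β (F j : L2) =ᵐ[haarAddCircle] ((F j : L2) : T → ℂ)) ∧
      ∀ (A : K α →ₗ[ℂ] K β) (t : Matrix (Fin n) (Fin m) ℂ),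
        t = LinearMap.toMatrix E.toBasis F.toBasis A →
        (l = 0 → (A ∈ toeplitzClass α β ↔
          ∀ (p : Fin m) (s : Fin n),
            t s p =
              rootDeriv α (η ⟨0, hm⟩) / rootDeriv α (η p)
                * (phase μ₁ (η ⟨0, hm⟩) / phase μ₁ (η p))
                * (((η ⟨0, hm⟩ : ℂ) - ζ s) / ((η p : ℂ) - ζ s)) * t s ⟨0, hm⟩
              + (rootDeriv α (η ⟨0, hm⟩) * rootDeriv β (ζ ⟨0, hn⟩))
                  / (rootDeriv α (η p) * rootDeriv β (ζ s))
                * ((phase μ₁ (η ⟨0, hm⟩) * phase μ₂ (ζ ⟨0, hn⟩))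
                  / (phase μ₁ (η p) * phase μ₂ (ζ s)))
                * (((ζ ⟨0, hn⟩ : ℂ) - η ⟨0, hm⟩) / ((η p : ℂ) - ζ s)) * t ⟨0, hn⟩ ⟨0, hm⟩
              + rootDeriv β (ζ ⟨0, hn⟩) / rootDeriv β (ζ s)
                * (phase μ₂ (ζ ⟨0, hn⟩) / phase μ₂ (ζ s))
                * (((η p : ℂ) - ζ ⟨0, hn⟩) / ((η p : ℂ) - ζ s)) * t ⟨0, hn⟩ p)) ∧
        (0 < l → (A ∈ toeplitzClass α β ↔
          (∀ (p : Fin m) (s : ℕ) (hsm : s < m) (hsn : s < n), s < l → s ≠ (p : ℕ) →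
            t ⟨s, hsn⟩ p =
              (rootDeriv α (η ⟨s, hsm⟩) * rootDeriv β (ζ ⟨0, hn⟩))
                  / (rootDeriv α (η p) * rootDeriv β (ζ ⟨s, hsn⟩))
                * ((phase μ₁ (η ⟨s, hsm⟩) * phase μ₂ (ζ ⟨0, hn⟩))
                  / (phase μ₁ (η p) * phase μ₂ (ζ ⟨s, hsn⟩)))
                * (((η ⟨0, hm⟩ : ℂ) - ζ ⟨s, hsn⟩) / ((η p : ℂ) - ζ ⟨s, hsn⟩))
                * t ⟨0, hn⟩ ⟨s, hsm⟩
              + rootDeriv β (ζ ⟨0, hn⟩) / rootDeriv β (ζ ⟨s, hsn⟩)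
                * (phase μ₂ (ζ ⟨0, hn⟩) / phase μ₂ (ζ ⟨s, hsn⟩))
                * (((η p : ℂ) - ζ ⟨0, hn⟩) / ((η p : ℂ) - ζ ⟨s, hsn⟩)) * t ⟨0, hn⟩ p) ∧
          (∀ (p : Fin m) (s : Fin n), l ≤ (s : ℕ) →
            t s p =
              rootDeriv α (η ⟨0, hm⟩) / rootDeriv α (η p)
                * (phase μ₁ (η ⟨0, hm⟩) / phase μ₁ (η p))
                * (((η ⟨0, hm⟩ : ℂ) - ζ s) / ((η p : ℂ) - ζ s)) * t s ⟨0, hm⟩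
              + rootDeriv β (ζ ⟨0, hn⟩) / rootDeriv β (ζ s)
                * (phase μ₂ (ζ ⟨0, hn⟩) / phase μ₂ (ζ s))
                * (((η p : ℂ) - ζ ⟨0, hn⟩) / ((η p : ℂ) - ζ s)) * t ⟨0, hn⟩ p))) := by
  obtain ⟨cα, aα, haα, hα'⟩ := hα
  obtain ⟨cβ, aβ, haβ, hβ'⟩ := hβ
  have hα : ∀ z, α z = cα * ((blaschkeNum aα).eval z / (blaschkeDen aα).eval z) := fun z => by
    rw [hα', eval_blaschkeNum, eval_blaschkeDen, Finset.prod_div_distrib]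
  have hβ : ∀ z, β z = cβ * ((blaschkeNum aβ).eval z / (blaschkeDen aβ).eval z) := fun z => by
    rw [hβ', eval_blaschkeNum, eval_blaschkeDen, Finset.prod_div_distrib]
  obtain ⟨E, hE⟩ := exists_clark_orthonormalBasis hm haα hα μ₁ hη_inj hη
  obtain ⟨F, hF⟩ := exists_clark_orthonormalBasis hn haβ hβ μ₂ hζ_inj hζ
  obtain ⟨hlm, hne⟩ := notMem_range_of_ncard_eq hη_inj hζ_inj hl hcommon
  have hrα : ∀ ξ : Circle, rootDeriv α ξ ≠ 0 := fun ξ => by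
    rw [rootDeriv_eq haα hα]; exact Complex.ofReal_ne_zero.2 (kernelNorm_pos hm haα hα _).ne'
  have hrβ : ∀ ξ : Circle, rootDeriv β ξ ≠ 0 := fun ξ => by
    rw [rootDeriv_eq haβ hβ]; exact Complex.ofReal_ne_zero.2 (kernelNorm_pos hn haβ hβ _).ne'
  have hpα : ∀ p, phase μ₁ (η p) ≠ 0 := fun p => phase_ne_zero _ _
  have hpβ : ∀ s, phase μ₂ (ζ s) ≠ 0 := fun s => phase_ne_zero _ _
  refine ⟨E, F, fun j => ?_, fun j => ?_, fun hμ j => ?_, fun hμ j => ?_, fun A M hM => ?_⟩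
  · rw [hE]; exact toL2_clarkRep_ae_eq haα hα _ _
  · rw [hF]; exact toL2_clarkRep_ae_eq haβ hβ _ _
  · rw [hE]; exact modelConj_clarkRep hm haα hα (hμ.trans (hη j).symm)
  · rw [hF]; exact modelConj_clarkRep hn haβ hβ (hμ.trans (hζ j).symm)
  have hxne : ∀ {p : Fin m} {s : Fin n}, η p ≠ ζ s → (η p : ℂ) - ζ s ≠ 0 := fun h =>
    sub_ne_zero.2 fun h' => h (Circle.ext h')
  have hmain : A ∈ toeplitzClass α β ↔ _ :=
    (mem_toeplitzClass_iff (fun f => by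
      obtain ⟨p, -, hp⟩ := exists_ratFun_of_mem_K haα hα f.2
      exact ⟨_, hp⟩) E F hE hF A).trans
    (exists_symbol_iff (x := fun p => (η p : ℂ)) (y := fun s => (ζ s : ℂ))
      (a := fun p => phase μ₁ (η p) * rootDeriv α (η p))
      (b := fun s => phase μ₂ (ζ s) * rootDeriv β (ζ s))
      (G := fun t => μ₁ * (1 - conj (clarkValue α lam₁) * α (pt t)))
      (H := fun t => - pt t * (1 - clarkValue β lam₂ * conj (β (pt t))))
      (l := l) hm hn hlm
      (fun p => exists_pt_eq _) (fun s => exists_pt_eq _)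
      (fun i j h => hη_inj (Circle.ext h)) (fun i j h => hζ_inj (Circle.ext h))
      (fun p => mul_ne_zero (hpα p) (hrα _)) (fun s => mul_ne_zero (hpβ s) (hrβ _))
      (fun i j t hij ht => clarkRep_eq_zero haα hα μ₁ hη_inj hη hij ht)
      (fun j t ht => clarkRep_ne_zero hm haα hα μ₁ hη_inj hη ht)
      (fun i j t hij ht => clarkRep_eq_zero haβ hβ μ₂ hζ_inj hζ hij ht)
      (fun j t ht => clarkRep_ne_zero hn haβ hβ μ₂ hζ_inj hζ ht)
      (fun p t => by rw [← hη p]; exact clarkRep_mul hm haα hα μ₁ (η p) t)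
      (fun s t => by rw [← hζ s]; exact conj_clarkRep_mul hn haβ hβ μ₂ (ζ s) t)
      (fun j hjm hjn hj => congrArg _ (hcommon j hjm hjn hj))
      (fun s hs p h => hne s hs p (Circle.ext h))
      (LinearMap.toMatrix E.toBasis F.toBasis A))
  rw [← hM] at hmain
  refine ⟨fun hl0 => hmain.trans ?_, fun hl0 => hmain.trans (and_congr ?_ ?_)⟩
  · subst hl0
    refine (and_iff_right fun p s _ _ hs => absurd hs (Nat.not_lt_zero s)).trans
      (forall₂_congr fun p s => ?_)
    rw [forall_prop_of_true (Nat.zero_le _)]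
    exact (three_term_iff (hrα _) (hrβ _) (hpα _) (hpβ _)
      (hxne (hne s (Nat.zero_le _) p))).symm
  · refine forall₅_congr fun p s hsm hsn hsl => forall_congr' fun hsp => ?_
    have hs := hcommon s hsm hsn hsl
    have h0 := hcommon 0 hm hn hl0
    have hps : η p ≠ ζ ⟨s, hsn⟩ := fun h => hsp
      (congrArg Fin.val (hη_inj (h.trans hs.symm))).symm
    -- Node `s` replaces the reference node `0` of `α`, and `Ms0 := 0` stands for the entry killed
    -- by `η_s = ζ_s`. The factor `ζ_1 - η_s` equals the stated `η_1 - ζ_s` because both nodes are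
    -- common.
    refine ((Eq.congr_right ?_).trans ((three_term_iff (r0 := rootDeriv α (η ⟨s, hsm⟩))
      (u0 := phase μ₁ (η ⟨s, hsm⟩)) (x0 := (η ⟨s, hsm⟩ : ℂ)) (q0 := rootDeriv β (ζ ⟨0, hn⟩))
      (w0 := phase μ₂ (ζ ⟨0, hn⟩)) (y0 := (ζ ⟨0, hn⟩ : ℂ)) (Ms0 := 0)
      (M00 := M ⟨0, hn⟩ ⟨s, hsm⟩) (M0p := M ⟨0, hn⟩ p) (hrα (η p)) (hrβ _) (hpα p) (hpβ _)
      (hxne hps)).trans (Eq.congr_right ?_))).symm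
    · rw [h0, hs]; ring
    · ring
  · refine forall₂_congr fun p s => forall_congr' fun hs => ?_
    have h0 := hcommon 0 hm hn hl0
    -- Since `η_1 = ζ_1`, the middle term of the three-term formula is zero.
    refine ((Eq.congr_right ?_).trans (three_term_iff (hrα _) (hrβ _) (hpα _) (hpβ _)
      (hxne (hne s hs p)))).symm
    rw [h0]; ring
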